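/- Let $T$ be a dependent type theory: a formal system, over a signature of type and term constructors (possibly binding variables), for deriving judgements $A \in \mathrm{Type}$, $a \in A$, $A = B \in \mathrm{Type}$, $a = b \in A$ in well-formed contexts $\Gamma = [x_0 \in A_0, \ldots, x_{n-1} \in A_{n-1}]$. Its rules are the basic ones (variables, weakening, substitution, reflexivity, symmetry and transitivity of both definitional equalities, conversion, and congruence: all type and term expressions respect definitional equality), together with an arbitrary set of further rules. The classifying category of $T$ has as objects the well-formed contexts, where contexts of the same length are identified if their types are successively definitionally equal. A morphism $\Delta \to \Gamma$, with $\Gamma$ as above, is a tuple of terms $(t_0,\ldots,t_{n-1})$ with $t_i \in A_i(t_0,\ldots,t_{i-1})\ [\Delta]$ for all $i$, up to termwise definitional equality; composition is substitution. A display map is a morphism $[\Gamma, x \in A] \to [\Gamma]$ that drops the last type of a context; a dependent projection is a morphism $[\Gamma,\Delta] \to [\Gamma]$ that drops a (possibly empty) final segment; a fibration is a morphism that is isomorphic, in the arrow category, to a dependent projection. Suppose that $T$ has strong sums, i.e. it contains, with congruence rules for all the constructors involved: - a type $1$ with a term $* \in 1$ such that $a = * \in 1$ for all $a \in 1$; -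 for $A \in \mathrm{Type}$ and $B \in \mathrm{Type}\ [x \in A]$ a type $\Sigma x \in A.\,B$, with pairs $\mathbf{p}ab \in \Sigma x\in A.\,B$ for $a \in A$ and $b \in B[a/x]$, and projections $\mathbf{p}_0 c \in A$ and $\mathbf{p}_1 c \in B[\mathbf{p}_0c/x]$ for $c \in \Sigma x \in A.\,B$, satisfying the definitional equalities $\mathbf{p}_0(\mathbf{p}ab) = a$, $\mathbf{p}_1(\mathbf{p}ab) = b$ and $\mathbf{p}(\mathbf{p}_0c)(\mathbf{p}_1c) = c$. Then every fibration in the classifying category of $T$ is isomorphic, in the arrow category, to a display map. -/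

import Mathlib

open CategoryTheory

universe u

namespace DTT

/-! ### Raw expressions

Expressions are well-scoped and nameless: an expression in scope `n` has its free variables among
`var 0, …, var (n - 1)`, where `var 0` is the variable declared last. -/

/-- The two kinds of expressions: type expressions and term expressions. -/
inductive Kind where
  | ty
  | tm

/-- The arity of a constructor: for every argument, its kind and the number of variables that the
constructor binds in it. -/
abbrev Arity := List (Kind × ℕ)

/-- A signature: arbitrary type constructors and term constructors, possibly binding variables. -/
structure Signature where
  Con : Kind → Type u
  arity : {k : Kind} → Con k → Arity

/-- Raw type and term expressions with `n` free variables. -/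
inductive Expr (S : Signature.{u}) : Kind → ℕ → Type u where
  | var {n : ℕ} (i : Fin n) : Expr S .tm n
  | con {k : Kind} {n : ℕ} (c : S.Con k)
      (args : ∀ i : Fin (S.arity c).length,
        Expr S ((S.arity c).get i).1 (n + ((S.arity c).get i).2)) : Expr S k n

abbrev Ty (S : Signature.{u}) (n : ℕ) := Expr S .ty n

abbrev Tm (S : Signature.{u}) (n : ℕ) := Expr S .tm n

/-- A tuple of `n` terms in scope `k`. -/
abbrev Sub (S : Signature.{u}) (n k : ℕ) := Fin n → Tm S k

/-- Extension of a renaming of variables under one binder. -/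
def liftRen {n k : ℕ} (ρ : Fin n → Fin k) : Fin (n + 1) → Fin (k + 1) :=
  Fin.cases 0 (fun i => (ρ i).succ)

/-- Extension of a renaming of variables under `m` binders. -/
def liftRenN {n k : ℕ} (ρ : Fin n → Fin k) : (m : ℕ) → Fin (n + m) → Fin (k + m)
  | 0 => ρ
  | m + 1 => liftRen (liftRenN ρ m)

variable {S : Signature.{u}}

/-- Renaming of variables. -/
def Expr.ren {κ : Kind} {n : ℕ} (e : Expr S κ n) : {k : ℕ} → (Fin n → Fin k) → Expr S κ k :=
  match e with
  | .var i => fun ρ => .var (ρ i)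
  | .con c args => fun ρ => .con c (fun i => (args i).ren (liftRenN ρ _))

/-- The same expression in a scope with one more variable, declared last. -/
abbrev Expr.wk {κ : Kind} {n : ℕ} (e : Expr S κ n) : Expr S κ (n + 1) := e.ren Fin.succ

/-- Extension of a substitution under one binder. -/
def Sub.lift {n k : ℕ} (σ : Sub S n k) : Sub S (n + 1) (k + 1) :=
  Fin.cases (.var 0) (fun i => (σ i).wk)

/-- Extension of a substitution under `m` binders. -/
def Sub.liftN {n k : ℕ} (σ : Sub S n k) : (m : ℕ) → Sub S (n + m) (k + m)
  | 0 => σ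
  | m + 1 => (Sub.liftN σ m).lift

/-- Simultaneous capture-avoiding substitution. -/
def Expr.sub {κ : Kind} {n : ℕ} (e : Expr S κ n) : {k : ℕ} → Sub S n k → Expr S κ k :=
  match e with
  | .var i => fun σ => σ i
  | .con c args => fun σ => .con c (fun i => (args i).sub (σ.liftN _))

/-- The substitution `[a / x]` for the variable `x` declared last. -/
def Sub.inst {n : ℕ} (a : Tm S n) : Sub S (n + 1) n := Fin.cases a Expr.var

/-- The tuple of all variables. -/
def Sub.id (n : ℕ) : Sub S n n := Expr.var

/-- Composition of tuples: first `σ`, then `τ`, i.e. `τ` with `σ` substituted for its variables. -/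
def Sub.comp {n m k : ℕ} (σ : Sub S m k) (τ : Sub S n m) : Sub S n k := fun i => (τ i).sub σ

/-- The tuple `(x₀, …, xₙ₋₁)` of the first `n` variables, in a scope with `m` more variables. -/
def Sub.drop (n : ℕ) : (m : ℕ) → Sub S n (n + m)
  | 0 => Sub.id n
  | m + 1 => fun i => (Sub.drop n m i).wk

/-! ### Contexts and judgements -/

/-- Raw contexts of length `n`; the last type is added by `snoc`. -/
inductive Ctx (S : Signature.{u}) : ℕ → Type u where
  | nil : Ctx S 0
  | snoc {n : ℕ} (Γ : Ctx S n) (A : Ty S n) : Ctx S (n + 1)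

/-- Raw final segments, of length `m`, of a context whose initial segment has length `n`. -/
inductive Tel (S : Signature.{u}) (n : ℕ) : ℕ → Type u where
  | nil : Tel S n 0
  | snoc {m : ℕ} (Δ : Tel S n m) (A : Ty S (n + m)) : Tel S n (m + 1)

/-- The context `[Γ, Δ]`. -/
def Ctx.append {n : ℕ} (Γ : Ctx S n) : {m : ℕ} → Tel S n m → Ctx S (n + m)
  | _, .nil => Γ
  | _, .snoc Δ A => (Γ.append Δ).snoc A

def Tel.ren {n k : ℕ} (ρ : Fin n → Fin k) : {m : ℕ} → Tel S n m → Tel S k m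
  | _, .nil => .nil
  | _, .snoc (m := m) Δ A => .snoc (Δ.ren ρ) (A.ren (liftRenN ρ m))

def Tel.sub {n k : ℕ} (σ : Sub S n k) : {m : ℕ} → Tel S n m → Tel S k m
  | _, .nil => .nil
  | _, .snoc (m := m) Δ A => .snoc (Δ.sub σ) (A.sub (σ.liftN m))

/-- The type of the variable `i` in the context `Γ`, as an expression in the scope of `Γ`. -/
def Ctx.get : {n : ℕ} → Ctx S n → Fin n → Ty S n
  | _, .nil => fun i => i.elim0
  | _, .snoc Γ A => Fin.cases A.wk (fun i => (Γ.get i).wk)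

/-- The four forms of judgement, in scope `n`:
`A ∈ Type`, `a ∈ A`, `A = B ∈ Type` and `a = b ∈ A`. -/
inductive Jdg (S : Signature.{u}) (n : ℕ) : Type u where
  | isTy (A : Ty S n)
  | hasTy (a : Tm S n) (A : Ty S n)
  | tyEq (A B : Ty S n)
  | tmEq (a b : Tm S n) (A : Ty S n)

def Jdg.ren {n k : ℕ} (ρ : Fin n → Fin k) : Jdg S n → Jdg S k
  | .isTy A => .isTy (A.ren ρ)
  | .hasTy a A => .hasTy (a.ren ρ) (A.ren ρ)
  | .tyEq A B => .tyEq (A.ren ρ) (B.ren ρ)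
  | .tmEq a b A => .tmEq (a.ren ρ) (b.ren ρ) (A.ren ρ)

def Jdg.sub {n k : ℕ} (σ : Sub S n k) : Jdg S n → Jdg S k
  | .isTy A => .isTy (A.sub σ)
  | .hasTy a A => .hasTy (a.sub σ) (A.sub σ)
  | .tyEq A B => .tyEq (A.sub σ) (B.sub σ)
  | .tmEq a b A => .tmEq (a.sub σ) (b.sub σ) (A.sub σ)

/-- A judgement in context, `J [Γ]`. -/
structure Sequent (S : Signature.{u}) where
  {n : ℕ}
  ctx : Ctx S n
  jdg : Jdg S n

/-- The statements `Aᵢ ∈ Type [x₀ ∈ A₀, …, xᵢ₋₁ ∈ Aᵢ₋₁]`, for all types `Aᵢ` in the context. -/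
def Ctx.presup : {n : ℕ} → Ctx S n → List (Sequent S)
  | _, .nil => []
  | _, .snoc Γ A => ⟨Γ, .isTy A⟩ :: Γ.presup

/-! ### Type theories -/

/-- (An instance of) a rule: a finite list of premises and a conclusion. -/
structure Rule (S : Signature.{u}) where
  premises : List (Sequent S)
  concl : Sequent S

end DTT

open DTT in
/-- A dependent type theory is given by a signature and by an arbitrary set of (instances of) rules,
which are used in addition to the basic rules listed in `TypeTheory.Derivable`. -/
structure TypeTheory where
  sig : Signature.{u}
  rules : Set (Rule sig)

namespace TypeTheory

open DTT

/-- Derivability in a type theory: `T.Derivable Γ J` says that `J [Γ]` is derivable.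
The rules `replTy` and `replTm` say that all type and term expressions respect definitional
equality (this is the effect of the congruence rules for all constructors).
In `replTy`, `replTm` and `rule` it is required that the context of the conclusion is well-formed,
so that `J [Γ]` is derivable only if `Γ` is a well-formed context. -/
inductive Derivable (T : TypeTheory.{u}) : {n : ℕ} → Ctx T.sig n → Jdg T.sig n → Prop
  | var {n : ℕ} {Γ : Ctx T.sig n} {A : Ty T.sig n} :
      Derivable T Γ (.isTy A) → Derivable T (Γ.snoc A) (.hasTy (.var 0) A.wk)
  | weaken {n m : ℕ} {Γ : Ctx T.sig n} {Δ : Tel T.sig n m} {J : Jdg T.sig (n + m)}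
      {A : Ty T.sig n} :
      Derivable T (Γ.append Δ) J → Derivable T Γ (.isTy A) →
      Derivable T ((Γ.snoc A).append (Δ.ren Fin.succ)) (J.ren (liftRenN Fin.succ m))
  | subst {n m : ℕ} {Γ : Ctx T.sig n} {A : Ty T.sig n} {Δ : Tel T.sig (n + 1) m}
      {J : Jdg T.sig (n + 1 + m)} {a : Tm T.sig n} :
      Derivable T ((Γ.snoc A).append Δ) J → Derivable T Γ (.hasTy a A) →
      Derivable T (Γ.append (Δ.sub (Sub.inst a))) (J.sub ((Sub.inst a).liftN m))
  | tyRefl {n : ℕ} {Γ : Ctx T.sig n} {A : Ty T.sig n} :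
      Derivable T Γ (.isTy A) → Derivable T Γ (.tyEq A A)
  | tySymm {n : ℕ} {Γ : Ctx T.sig n} {A B : Ty T.sig n} :
      Derivable T Γ (.tyEq A B) → Derivable T Γ (.tyEq B A)
  | tyTrans {n : ℕ} {Γ : Ctx T.sig n} {A B C : Ty T.sig n} :
      Derivable T Γ (.tyEq A B) → Derivable T Γ (.tyEq B C) → Derivable T Γ (.tyEq A C)
  | tmRefl {n : ℕ} {Γ : Ctx T.sig n} {a : Tm T.sig n} {A : Ty T.sig n} :
      Derivable T Γ (.hasTy a A) → Derivable T Γ (.tmEq a a A)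
  | tmSymm {n : ℕ} {Γ : Ctx T.sig n} {a b : Tm T.sig n} {A : Ty T.sig n} :
      Derivable T Γ (.tmEq a b A) → Derivable T Γ (.tmEq b a A)
  | tmTrans {n : ℕ} {Γ : Ctx T.sig n} {a b c : Tm T.sig n} {A : Ty T.sig n} :
      Derivable T Γ (.tmEq a b A) → Derivable T Γ (.tmEq b c A) → Derivable T Γ (.tmEq a c A)
  | conv {n : ℕ} {Γ : Ctx T.sig n} {a : Tm T.sig n} {A B : Ty T.sig n} :
      Derivable T Γ (.hasTy a A) → Derivable T Γ (.tyEq A B) → Derivable T Γ (.hasTy a B)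
  | convEq {n : ℕ} {Γ : Ctx T.sig n} {a b : Tm T.sig n} {A B : Ty T.sig n} :
      Derivable T Γ (.tmEq a b A) → Derivable T Γ (.tyEq A B) → Derivable T Γ (.tmEq a b B)
  | replTy {n k : ℕ} {Γ : Ctx T.sig n} {Δ : Ctx T.sig k} {σ τ : Sub T.sig n k}
      {A : Ty T.sig n} :
      (∀ s ∈ Δ.presup, Derivable T s.ctx s.jdg) →
      (∀ i, Derivable T Δ (.hasTy (σ i) ((Γ.get i).sub σ))) →
      (∀ i, Derivable T Δ (.hasTy (τ i) ((Γ.get i).sub τ))) →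
      (∀ i, Derivable T Δ (.tmEq (σ i) (τ i) ((Γ.get i).sub σ))) →
      Derivable T Γ (.isTy A) → Derivable T Δ (.tyEq (A.sub σ) (A.sub τ))
  | replTm {n k : ℕ} {Γ : Ctx T.sig n} {Δ : Ctx T.sig k} {σ τ : Sub T.sig n k}
      {a : Tm T.sig n} {A : Ty T.sig n} :
      (∀ s ∈ Δ.presup, Derivable T s.ctx s.jdg) →
      (∀ i, Derivable T Δ (.hasTy (σ i) ((Γ.get i).sub σ))) →
      (∀ i, Derivable T Δ (.hasTy (τ i) ((Γ.get i).sub τ))) →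
      (∀ i, Derivable T Δ (.tmEq (σ i) (τ i) ((Γ.get i).sub σ))) →
      Derivable T Γ (.hasTy a A) → Derivable T Δ (.tmEq (a.sub σ) (a.sub τ) (A.sub σ))
  | rule (r : Rule T.sig) :
      r ∈ T.rules → (∀ s ∈ r.premises, Derivable T s.ctx s.jdg) →
      (∀ s ∈ r.concl.ctx.presup, Derivable T s.ctx s.jdg) → Derivable T r.concl.ctx r.concl.jdg

variable {T : TypeTheory.{u}}

/-- `Γ` is a well-formed context. -/
def IsCtx (T : TypeTheory.{u}) {n : ℕ} (Γ : Ctx T.sig n) : Prop :=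
  ∀ s ∈ Γ.presup, T.Derivable s.ctx s.jdg

/-- `(t₀, …, tₙ₋₁)` is a tuple of terms in context `Γ` with `tᵢ ∈ Aᵢ(t₀, …, tᵢ₋₁) [Γ]`, where
`Δ = [x₀ ∈ A₀, …, xₙ₋₁ ∈ Aₙ₋₁]`. -/
def IsSub (T : TypeTheory.{u}) {n k : ℕ} (Γ : Ctx T.sig k) (Δ : Ctx T.sig n)
    (t : Sub T.sig n k) : Prop :=
  ∀ i, T.Derivable Γ (.hasTy (t i) ((Δ.get i).sub t))

/-- `tᵢ = sᵢ ∈ Aᵢ(t₀, …, tᵢ₋₁) [Γ]` for all `i`, where `Δ = [x₀ ∈ A₀, …, xₙ₋₁ ∈ Aₙ₋₁]`. -/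
def SubEq (T : TypeTheory.{u}) {n k : ℕ} (Γ : Ctx T.sig k) (Δ : Ctx T.sig n)
    (t s : Sub T.sig n k) : Prop :=
  ∀ i, T.Derivable Γ (.tmEq (t i) (s i) ((Δ.get i).sub t))

/-- Contexts of the same length with `Aᵢ = Bᵢ ∈ Type [x₀ ∈ A₀, …, xᵢ₋₁ ∈ Aᵢ₋₁]` for all `i`. -/
def CtxEq (T : TypeTheory.{u}) : {n : ℕ} → Ctx T.sig n → Ctx T.sig n → Prop
  | _, .nil, .nil => True
  | _, .snoc Γ A, .snoc Γ' A' => CtxEq T Γ Γ' ∧ T.Derivable Γ (.tyEq A A')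

end TypeTheory

/-! ### Substitution lemmas -/

namespace DTT

variable {S : Signature.{u}}

theorem liftRenN_comp {n k l : ℕ} (ρ : Fin n → Fin k) (ρ' : Fin k → Fin l) (m : ℕ) :
    liftRenN ρ' m ∘ liftRenN ρ m = liftRenN (ρ' ∘ ρ) m := by
  induction m with
  | zero => rfl
  | succ m ih =>
    funext i
    refine Fin.cases rfl (fun i => ?_) i
    exact congrArg Fin.succ (congrFun ih i)

theorem Expr.ren_ren {κ : Kind} {n : ℕ} (e : Expr S κ n) : ∀ {k l : ℕ} (ρ : Fin n → Fin k)
    (ρ' : Fin k → Fin l), (e.ren ρ).ren ρ' = e.ren (ρ' ∘ ρ) := by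
  induction e with
  | var i => intros; rfl
  | con c args ih =>
    intro k l ρ ρ'
    simp only [Expr.ren, ih, liftRenN_comp]

theorem Expr.wk_ren {κ : Kind} {n k : ℕ} (e : Expr S κ n) (ρ : Fin n → Fin k) :
    e.wk.ren (liftRen ρ) = (e.ren ρ).wk := by
  unfold Expr.wk; rw [Expr.ren_ren, Expr.ren_ren]; rfl

theorem Sub.liftN_ren {n k l : ℕ} (ρ : Fin n → Fin k) (σ : Sub S k l) (m : ℕ) (i : Fin (n + m)) :
    σ.liftN m (liftRenN ρ m i) = Sub.liftN (fun j => σ (ρ j)) m i := by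
  induction m with
  | zero => rfl
  | succ m ih =>
    refine Fin.cases rfl (fun i => ?_) i
    exact congrArg Expr.wk (ih i)

theorem Expr.sub_ren {κ : Kind} {n : ℕ} (e : Expr S κ n) : ∀ {k l : ℕ} (ρ : Fin n → Fin k)
    (σ : Sub S k l), (e.ren ρ).sub σ = e.sub (fun i => σ (ρ i)) := by
  induction e with
  | var i => intros; rfl
  | con c args ih =>
    intro k l ρ σ
    simp only [Expr.ren, Expr.sub, ih, Sub.liftN_ren]

theorem Sub.ren_liftN {n k l : ℕ} (σ : Sub S n k) (ρ : Fin k → Fin l) (m : ℕ) (i : Fin (n + m)) :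
    (σ.liftN m i).ren (liftRenN ρ m) = Sub.liftN (fun j => (σ j).ren ρ) m i := by
  induction m with
  | zero => rfl
  | succ m ih =>
    refine Fin.cases rfl (fun i => ?_) i
    exact (Expr.wk_ren _ _).trans (congrArg Expr.wk (ih i))

theorem Expr.ren_sub {κ : Kind} {n : ℕ} (e : Expr S κ n) : ∀ {k l : ℕ} (σ : Sub S n k)
    (ρ : Fin k → Fin l), (e.sub σ).ren ρ = e.sub (fun i => (σ i).ren ρ) := by
  induction e with
  | var i => intros; rfl
  | con c args ih =>
    intro k l σ ρ
    simp only [Expr.ren, Expr.sub, ih, Sub.ren_liftN]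

theorem Expr.wk_sub_lift {κ : Kind} {n k : ℕ} (e : Expr S κ n) (σ : Sub S n k) :
    e.wk.sub σ.lift = (e.sub σ).wk := by
  unfold Expr.wk; rw [Expr.sub_ren, Expr.ren_sub]; rfl

theorem Expr.wk_sub {κ : Kind} {n k : ℕ} (e : Expr S κ n) (σ : Sub S (n + 1) k) :
    e.wk.sub σ = e.sub (fun i => σ i.succ) :=
  Expr.sub_ren _ _ _

theorem Sub.liftN_comp {n k l : ℕ} (σ : Sub S k l) (τ : Sub S n k) (m : ℕ) :
    (σ.liftN m).comp (τ.liftN m) = (σ.comp τ).liftN m := by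
  induction m with
  | zero => rfl
  | succ m ih =>
    funext i
    refine Fin.cases rfl (fun i => ?_) i
    exact (Expr.wk_sub_lift _ _).trans (congrArg Expr.wk (congrFun ih i))

theorem Sub.lift_comp {n k l : ℕ} (σ : Sub S k l) (τ : Sub S n k) :
    σ.lift.comp τ.lift = (σ.comp τ).lift :=
  Sub.liftN_comp σ τ 1

theorem Expr.sub_sub {κ : Kind} {n : ℕ} (e : Expr S κ n) : ∀ {k l : ℕ} (τ : Sub S n k)
    (σ : Sub S k l), (e.sub τ).sub σ = e.sub (σ.comp τ) := by
  induction e with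
  | var i => intros; rfl
  | con c args ih =>
    intro k l τ σ
    simp only [Expr.sub, ih, Sub.liftN_comp]

theorem Sub.lift_id (n : ℕ) : (Sub.id n : Sub S n n).lift = Sub.id (n + 1) := by
  funext i
  exact Fin.cases rfl (fun _ => rfl) i

theorem Sub.liftN_id (n m : ℕ) : (Sub.id n : Sub S n n).liftN m = Sub.id (n + m) := by
  induction m with
  | zero => rfl
  | succ m ih => exact (congrArg Sub.lift ih).trans (Sub.lift_id _)

theorem Expr.sub_id {κ : Kind} {n : ℕ} (e : Expr S κ n) : e.sub (Sub.id n) = e := by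
  induction e with
  | var i => rfl
  | con c args ih => simp only [Expr.sub, Sub.liftN_id, ih]

theorem liftN_var {n k : ℕ} (ρ : Fin n → Fin k) (m : ℕ) :
    Sub.liftN (S := S) (fun i => .var (ρ i)) m = fun i => .var (liftRenN ρ m i) := by
  induction m with
  | zero => rfl
  | succ m ih =>
    funext i
    refine Fin.cases rfl (fun i => ?_) i
    exact congrArg Expr.wk (congrFun ih i)

theorem Expr.ren_eq_sub {κ : Kind} {n : ℕ} (e : Expr S κ n) : ∀ {k : ℕ} (ρ : Fin n → Fin k),
    e.ren ρ = e.sub (fun i => .var (ρ i)) := by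
  induction e with
  | var i => intros; rfl
  | con c args ih =>
    intro k ρ
    simp only [Expr.ren, Expr.sub, ih, liftN_var]

theorem Sub.comp_id {n k : ℕ} (σ : Sub S n k) : σ.comp (Sub.id n) = σ := rfl

theorem Sub.id_comp {n k : ℕ} (σ : Sub S n k) : (Sub.id k).comp σ = σ := by
  funext i; exact Expr.sub_id _

theorem Sub.comp_assoc {n m k l : ℕ} (σ : Sub S k l) (τ : Sub S m k) (υ : Sub S n m) :
    (σ.comp τ).comp υ = σ.comp (τ.comp υ) := by
  funext i; exact (Expr.sub_sub _ _ _).symm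

theorem Jdg.sub_sub {n k l : ℕ} (J : Jdg S n) (τ : Sub S n k) (σ : Sub S k l) :
    (J.sub τ).sub σ = J.sub (σ.comp τ) := by
  cases J <;> simp [Jdg.sub, Expr.sub_sub]

theorem Jdg.sub_id {n : ℕ} (J : Jdg S n) : J.sub (Sub.id n) = J := by
  cases J <;> simp [Jdg.sub, Expr.sub_id]

theorem Jdg.ren_eq_sub {n k : ℕ} (J : Jdg S n) (ρ : Fin n → Fin k) :
    J.ren ρ = J.sub (fun i => .var (ρ i)) := by
  cases J <;> simp [Jdg.ren, Jdg.sub, Expr.ren_eq_sub]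

/-- `Lifts Γ Γ' σ Θ Θ' τ`: there is a final segment `Ξ` with `Θ = [Γ, Ξ]` and `Θ' = [Γ', Ξ(σ)]`,
and `τ` is `σ` extended by the variables of `Ξ`. -/
inductive Lifts {n k : ℕ} (Γ : Ctx S n) (Γ' : Ctx S k) (σ : Sub S n k) :
    {N K : ℕ} → Ctx S N → Ctx S K → Sub S N K → Prop
  | base : Lifts Γ Γ' σ Γ Γ' σ
  | lift {N K : ℕ} {Θ : Ctx S N} {Θ' : Ctx S K} {τ : Sub S N K} (B : Ty S N) :
      Lifts Γ Γ' σ Θ Θ' τ → Lifts Γ Γ' σ (Θ.snoc B) (Θ'.snoc (B.sub τ)) τ.lift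

theorem Lifts.factor {n m k : ℕ} {Γ : Ctx S n} {Γ' : Ctx S m} {Γ'' : Ctx S k} {τ : Sub S n m}
    {σ : Sub S m k} {N K : ℕ} {Θ : Ctx S N} {Θ'' : Ctx S K} {υ : Sub S N K}
    (h : Lifts Γ Γ'' (σ.comp τ) Θ Θ'' υ) : ∃ (M : ℕ) (Θ' : Ctx S M) (υ₁ : Sub S N M)
      (υ₂ : Sub S M K), Lifts Γ Γ' τ Θ Θ' υ₁ ∧ Lifts Γ' Γ'' σ Θ' Θ'' υ₂ ∧ υ = υ₂.comp υ₁ := by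
  induction h with
  | base => exact ⟨_, _, _, _, .base, .base, rfl⟩
  | lift B _ ih =>
    obtain ⟨M, Θ', υ₁, υ₂, h₁, h₂, rfl⟩ := ih
    refine ⟨_, _, _, _, .lift B h₁, ?_, (Sub.lift_comp _ _).symm⟩
    rw [← Expr.sub_sub]
    exact .lift _ h₂

/-- A pair of contexts together with a tuple of terms, all in bundled form. -/
structure SubPack (S : Signature.{u}) where
  {N K : ℕ}
  src : Ctx S N
  tgt : Ctx S K
  sub : Sub S N K

theorem Lifts.pack {n k : ℕ} {Γ : Ctx S n} {Γ' : Ctx S k} {σ : Sub S n k} {N K : ℕ}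
    {Θ : Ctx S N} {Θ' : Ctx S K} {τ : Sub S N K} (h : Lifts Γ Γ' σ Θ Θ' τ) :
    ∃ (m : ℕ) (Ξ : Tel S n m),
      (⟨Θ, Θ', τ⟩ : SubPack S) = ⟨Γ.append Ξ, Γ'.append (Ξ.sub σ), σ.liftN m⟩ := by
  induction h with
  | base => exact ⟨0, .nil, rfl⟩
  | lift B _ ih =>
    obtain ⟨m, Ξ, h⟩ := ih
    cases h
    exact ⟨m + 1, .snoc Ξ B, rfl⟩

theorem Tel.ren_eq_sub {n k m : ℕ} (Δ : Tel S n m) (ρ : Fin n → Fin k) :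
    Δ.ren ρ = Δ.sub (fun i => .var (ρ i)) := by
  induction Δ with
  | nil => rfl
  | snoc Δ A ih => simp [Tel.ren, Tel.sub, ih, Expr.ren_eq_sub, liftN_var]

theorem Tel.sub_id {n m : ℕ} (Δ : Tel S n m) : Δ.sub (Sub.id n) = Δ := by
  induction Δ with
  | nil => rfl
  | snoc Δ A ih => simp [Tel.sub, ih, Sub.liftN_id, Expr.sub_id]

end DTT

/-! ### Admissible rules -/

namespace TypeTheory

open DTT

variable {T : TypeTheory.{u}}

theorem isCtx_snoc {n : ℕ} {Γ : Ctx T.sig n} {A : Ty T.sig n} :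
    T.IsCtx (Γ.snoc A) ↔ T.Derivable Γ (.isTy A) ∧ T.IsCtx Γ := by
  simp [IsCtx, Ctx.presup]

theorem isCtx_nil : T.IsCtx (Ctx.nil : Ctx T.sig 0) := by
  simp [IsCtx, Ctx.presup]

theorem isCtx_weaken {n m : ℕ} {Γ : Ctx T.sig n} {A : Ty T.sig n} (hA : T.Derivable Γ (.isTy A))
    {Δ : Tel T.sig n m} (h : T.IsCtx (Γ.append Δ)) :
    T.IsCtx ((Γ.snoc A).append (Δ.ren Fin.succ)) := by
  induction Δ with
  | nil => exact isCtx_snoc.2 ⟨hA, h⟩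
  | snoc Δ B ih =>
    have h' := isCtx_snoc.1 h
    exact isCtx_snoc.2 ⟨.weaken h'.1 hA, ih h'.2⟩

theorem isCtx_subst {n m : ℕ} {Γ : Ctx T.sig n} {A : Ty T.sig n} {a : Tm T.sig n}
    (ha : T.Derivable Γ (.hasTy a A)) {Δ : Tel T.sig (n + 1) m}
    (h : T.IsCtx ((Γ.snoc A).append Δ)) : T.IsCtx (Γ.append (Δ.sub (Sub.inst a))) := by
  induction Δ with
  | nil => exact (isCtx_snoc.1 h).2
  | snoc Δ B ih =>
    have h' := isCtx_snoc.1 h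
    exact isCtx_snoc.2 ⟨.subst h'.1 ha, ih h'.2⟩

/-- `J [Γ]` is derivable only if `Γ` is a well-formed context. -/
theorem Derivable.isCtx {n : ℕ} {Γ : Ctx T.sig n} {J : Jdg T.sig n} (h : T.Derivable Γ J) :
    T.IsCtx Γ := by
  induction h with
  | var h ih => exact isCtx_snoc.2 ⟨h, ih⟩
  | weaken _ hA ih _ => exact isCtx_weaken hA ih
  | subst _ ha ih _ => exact isCtx_subst ha ih
  | replTy h => exact h
  | replTm h => exact h
  | rule r _ _ h => exact h
  | _ => assumption

/-- Derivability is preserved by the substitution `σ` in any initial segment. -/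
def Admits (T : TypeTheory.{u}) {n k : ℕ} (Γ : Ctx T.sig n) (Γ' : Ctx T.sig k)
    (σ : Sub T.sig n k) : Prop :=
  ∀ ⦃N K : ℕ⦄ ⦃Θ : Ctx T.sig N⦄ ⦃Θ' : Ctx T.sig K⦄ ⦃τ : Sub T.sig N K⦄,
    Lifts Γ Γ' σ Θ Θ' τ → ∀ J, T.Derivable Θ J → T.Derivable Θ' (J.sub τ)

theorem Admits.comp {n m k : ℕ} {Γ : Ctx T.sig n} {Γ' : Ctx T.sig m} {Γ'' : Ctx T.sig k}
    {τ : Sub T.sig n m} {σ : Sub T.sig m k} (hτ : T.Admits Γ Γ' τ) (hσ : T.Admits Γ' Γ'' σ) :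
    T.Admits Γ Γ'' (σ.comp τ) := by
  intro N K Θ Θ'' υ h J hJ
  obtain ⟨M, Θ', υ₁, υ₂, h₁, h₂, rfl⟩ := h.factor (Γ' := Γ')
  rw [← Jdg.sub_sub]
  exact hσ h₂ _ (hτ h₁ _ hJ)

theorem admits_inst {n : ℕ} {Γ : Ctx T.sig n} {A : Ty T.sig n} {a : Tm T.sig n}
    (ha : T.Derivable Γ (.hasTy a A)) : T.Admits (Γ.snoc A) Γ (Sub.inst a) := by
  intro N K Θ Θ' τ h J hJ
  obtain ⟨m, Ξ, h⟩ := h.pack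
  cases h
  exact .subst hJ ha

theorem admits_wk {n : ℕ} {Γ : Ctx T.sig n} {A : Ty T.sig n}
    (hA : T.Derivable Γ (.isTy A)) :
    T.Admits Γ (Γ.snoc A) (fun i => .var i.succ) := by
  intro N K Θ Θ' τ h J hJ
  obtain ⟨m, Ξ, h⟩ := h.pack
  cases h
  have := Derivable.weaken hJ hA
  rwa [Tel.ren_eq_sub, Jdg.ren_eq_sub, ← liftN_var] at this

theorem admits_id {n : ℕ} {Γ : Ctx T.sig n} : T.Admits Γ Γ (Sub.id n) := by
  intro N K Θ Θ' τ h J hJ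
  obtain ⟨m, Ξ, h⟩ := h.pack
  cases h
  rwa [Tel.sub_id, Sub.liftN_id, Jdg.sub_id]

theorem admits_nil {k : ℕ} {Γ : Ctx T.sig k} (hΓ : T.IsCtx Γ) (σ : Sub T.sig 0 k) :
    T.Admits .nil Γ σ := by
  induction Γ with
  | nil =>
    rw [Subsingleton.elim σ (Sub.id 0)]
    exact admits_id
  | snoc Γ A ih =>
    rw [isCtx_snoc] at hΓ
    rw [Subsingleton.elim σ (Sub.comp _ (fun i => i.elim0))]
    exact Admits.comp (ih hΓ.2 _) (admits_wk hΓ.1)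

theorem IsSub.tail {n k : ℕ} {Γ : Ctx T.sig n} {A : Ty T.sig n} {Γ' : Ctx T.sig k}
    {σ : Sub T.sig (n + 1) k} (h : T.IsSub Γ' (Γ.snoc A) σ) :
    T.IsSub Γ' Γ (fun i => σ i.succ) := by
  intro i
  have := h i.succ
  rwa [show (Γ.snoc A).get i.succ = (Γ.get i).wk from rfl, Expr.wk_sub] at this

theorem IsSub.head {n k : ℕ} {Γ : Ctx T.sig n} {A : Ty T.sig n} {Γ' : Ctx T.sig k}
    {σ : Sub T.sig (n + 1) k} (h : T.IsSub Γ' (Γ.snoc A) σ) :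
    T.Derivable Γ' (.hasTy (σ 0) (A.sub (fun i => σ i.succ))) := by
  have := h 0
  rwa [show (Γ.snoc A).get 0 = A.wk from rfl, Expr.wk_sub] at this

/-- Simultaneous substitution is admissible, also under a further final segment of the context. -/
theorem admits_of_isSub {n k : ℕ} {Γ : Ctx T.sig n} {Γ' : Ctx T.sig k} {σ : Sub T.sig n k}
    (hΓ' : T.IsCtx Γ') (h : T.IsSub Γ' Γ σ) : T.Admits Γ Γ' σ := by
  induction Γ with
  | nil => exact admits_nil hΓ' σ
  | snoc Γ A ih =>
    have h₁ := ih h.tail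
    have h₂ : T.Admits (Γ.snoc A) (Γ'.snoc (A.sub (fun i => σ i.succ)))
        (Sub.lift (fun i => σ i.succ)) := fun _ _ _ _ _ hl => by
      have key : ∀ {N K : ℕ} {Θ : Ctx T.sig N} {Θ' : Ctx T.sig K} {τ : Sub T.sig N K},
          Lifts (Γ.snoc A) (Γ'.snoc (A.sub (fun i => σ i.succ))) (Sub.lift (fun i => σ i.succ))
            Θ Θ' τ → Lifts Γ Γ' (fun i => σ i.succ) Θ Θ' τ := by
        intro N K Θ Θ' τ hl
        induction hl with
        | base => exact .lift _ .base
        | lift B _ ih => exact .lift _ ih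
      exact h₁ (key hl)
    have h₃ := Admits.comp h₂ (admits_inst h.head)
    have : (Sub.inst (σ 0)).comp (Sub.lift (fun i => σ i.succ)) = σ := by
      funext i
      refine Fin.cases rfl (fun i => ?_) i
      exact (Expr.wk_sub _ _).trans (Expr.sub_id _)
    rwa [this] at h₃

theorem Derivable.substitute {n k : ℕ} {Γ : Ctx T.sig n} {Γ' : Ctx T.sig k} {σ : Sub T.sig n k}
    {J : Jdg T.sig n} (hJ : T.Derivable Γ J) (hΓ' : T.IsCtx Γ') (h : T.IsSub Γ' Γ σ) :
    T.Derivable Γ' (J.sub σ) :=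
  admits_of_isSub hΓ' h .base J hJ

theorem Derivable.wk {n : ℕ} {Γ : Ctx T.sig n} {A : Ty T.sig n} {J : Jdg T.sig n}
    (hJ : T.Derivable Γ J) (hA : T.Derivable Γ (.isTy A)) :
    T.Derivable (Γ.snoc A) (J.ren Fin.succ) :=
  Derivable.weaken (Δ := .nil) hJ hA

theorem isSub_id {n : ℕ} {Γ : Ctx T.sig n} (hΓ : T.IsCtx Γ) : T.IsSub Γ Γ (Sub.id n) := by
  intro i
  rw [Expr.sub_id]
  induction Γ with
  | nil => exact i.elim0
  | snoc Γ A ih =>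
    rw [isCtx_snoc] at hΓ
    refine Fin.cases (.var hΓ.1) (fun i => ?_) i
    exact (ih hΓ.2 i).wk hΓ.1

theorem isTy_get {n : ℕ} {Γ : Ctx T.sig n} (hΓ : T.IsCtx Γ) (i : Fin n) :
    T.Derivable Γ (.isTy (Γ.get i)) := by
  induction Γ with
  | nil => exact i.elim0
  | snoc Γ A ih =>
    rw [isCtx_snoc] at hΓ
    exact Fin.cases (hΓ.1.wk hΓ.1) (fun i => (ih hΓ.2 i).wk hΓ.1) i

theorem isSub_drop_one {n : ℕ} {Γ : Ctx T.sig n} {A : Ty T.sig n} (h : T.IsCtx (Γ.snoc A)) :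
    T.IsSub (Γ.snoc A) Γ (fun i => .var i.succ) :=
  (isSub_id h).tail

theorem IsSub.comp {n m k : ℕ} {Γ : Ctx T.sig k} {Δ : Ctx T.sig m} {Θ : Ctx T.sig n}
    {σ : Sub T.sig m k} {τ : Sub T.sig n m} (hΓ : T.IsCtx Γ) (hσ : T.IsSub Γ Δ σ)
    (hτ : T.IsSub Δ Θ τ) : T.IsSub Γ Θ (σ.comp τ) := by
  intro i
  have := (hτ i).substitute hΓ hσ
  rwa [Jdg.sub, Expr.sub_sub] at this

theorem SubEq.refl {n k : ℕ} {Γ : Ctx T.sig k} {Δ : Ctx T.sig n} {σ : Sub T.sig n k}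
    (h : T.IsSub Γ Δ σ) : T.SubEq Γ Δ σ σ :=
  fun i => .tmRefl (h i)

theorem SubEq.get_eq {n k : ℕ} {Γ : Ctx T.sig k} {Δ : Ctx T.sig n} {σ τ : Sub T.sig n k}
    (hΓ : T.IsCtx Γ) (hΔ : T.IsCtx Δ) (hσ : T.IsSub Γ Δ σ) (hτ : T.IsSub Γ Δ τ)
    (h : T.SubEq Γ Δ σ τ) (i : Fin n) :
    T.Derivable Γ (.tyEq ((Δ.get i).sub σ) ((Δ.get i).sub τ)) :=
  .replTy hΓ hσ hτ h (isTy_get hΔ i)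

theorem SubEq.symm {n k : ℕ} {Γ : Ctx T.sig k} {Δ : Ctx T.sig n} {σ τ : Sub T.sig n k}
    (hΓ : T.IsCtx Γ) (hΔ : T.IsCtx Δ) (hσ : T.IsSub Γ Δ σ) (hτ : T.IsSub Γ Δ τ)
    (h : T.SubEq Γ Δ σ τ) : T.SubEq Γ Δ τ σ :=
  fun i => .convEq (.tmSymm (h i)) (h.get_eq hΓ hΔ hσ hτ i)

theorem SubEq.trans {n k : ℕ} {Γ : Ctx T.sig k} {Δ : Ctx T.sig n} {σ τ υ : Sub T.sig n k}
    (hΓ : T.IsCtx Γ) (hΔ : T.IsCtx Δ) (hσ : T.IsSub Γ Δ σ) (hτ : T.IsSub Γ Δ τ)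
    (h : T.SubEq Γ Δ σ τ) (h' : T.SubEq Γ Δ τ υ) : T.SubEq Γ Δ σ υ :=
  fun i => .tmTrans (h i) (.convEq (h' i) (.tySymm (h.get_eq hΓ hΔ hσ hτ i)))

theorem SubEq.comp {n m k : ℕ} {Γ : Ctx T.sig k} {Δ : Ctx T.sig m} {Θ : Ctx T.sig n}
    {σ σ' : Sub T.sig m k} {τ τ' : Sub T.sig n m} (hΓ : T.IsCtx Γ)
    (hΘ : T.IsCtx Θ) (hσ : T.IsSub Γ Δ σ) (hσ' : T.IsSub Γ Δ σ') (hτ : T.IsSub Δ Θ τ)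
    (hτ' : T.IsSub Δ Θ τ') (h : T.SubEq Γ Δ σ σ') (h' : T.SubEq Δ Θ τ τ') :
    T.SubEq Γ Θ (σ.comp τ) (σ'.comp τ') := by
  refine SubEq.trans hΓ hΘ (hσ.comp hΓ hτ) (τ := σ.comp τ') (hσ.comp hΓ hτ') ?_ ?_
  · intro i
    have := (h' i).substitute hΓ hσ
    rwa [Jdg.sub, Expr.sub_sub] at this
  · intro i
    have := Derivable.replTm hΓ hσ hσ' h (hτ' i)
    rwa [Expr.sub_sub] at this

/-- Equal contexts are related by the tuple of all variables. -/
theorem CtxEq.isSub {n : ℕ} {Γ Γ' : Ctx T.sig n} (hΓ' : T.IsCtx Γ')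
    (h : T.CtxEq Γ Γ') : T.IsSub Γ' Γ (Sub.id n) := by
  induction n with
  | zero => exact fun i => i.elim0
  | succ n ih =>
    obtain _ | ⟨Γ, A⟩ := Γ
    obtain _ | ⟨Γ', A'⟩ := Γ'
    obtain ⟨h, hA⟩ := h
    rw [isCtx_snoc] at hΓ'
    have hs := ih hΓ'.2 h
    intro i
    rw [Expr.sub_id]
    refine Fin.cases ?_ (fun i => ?_) i
    · have h₁ := hA.substitute hΓ'.2 hs
      rw [Jdg.sub, Expr.sub_id, Expr.sub_id] at h₁
      exact .conv (.var hΓ'.1) (h₁.tySymm.wk hΓ'.1)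
    · have h₁ := hs i
      rw [Expr.sub_id] at h₁
      exact h₁.wk hΓ'.1

theorem CtxEq.convert {n : ℕ} {Γ Γ' : Ctx T.sig n} (hΓ' : T.IsCtx Γ') (h : T.CtxEq Γ Γ')
    {J : Jdg T.sig n} (hJ : T.Derivable Γ J) : T.Derivable Γ' J := by
  have := hJ.substitute hΓ' (h.isSub hΓ')
  rwa [Jdg.sub_id] at this

theorem CtxEq.refl {n : ℕ} {Γ : Ctx T.sig n} (hΓ : T.IsCtx Γ) : T.CtxEq Γ Γ := by
  induction Γ with
  | nil => trivial
  | snoc Γ A ih =>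
    rw [isCtx_snoc] at hΓ
    exact ⟨ih hΓ.2, .tyRefl hΓ.1⟩

theorem CtxEq.symm {n : ℕ} {Γ Γ' : Ctx T.sig n} (hΓ' : T.IsCtx Γ') (h : T.CtxEq Γ Γ') :
    T.CtxEq Γ' Γ := by
  induction n with
  | zero =>
    obtain _ | _ := Γ
    obtain _ | _ := Γ'
    trivial
  | succ n ih =>
    obtain _ | ⟨Γ, A⟩ := Γ
    obtain _ | ⟨Γ', A'⟩ := Γ'
    rw [isCtx_snoc] at hΓ'
    exact ⟨ih hΓ'.2 h.1, (h.1.convert hΓ'.2 h.2).tySymm⟩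

theorem CtxEq.trans {n : ℕ} {Γ Γ' Γ'' : Ctx T.sig n} (hΓ : T.IsCtx Γ) (hΓ' : T.IsCtx Γ')
    (h : T.CtxEq Γ Γ') (h' : T.CtxEq Γ' Γ'') : T.CtxEq Γ Γ'' := by
  induction n with
  | zero =>
    obtain _ | _ := Γ
    obtain _ | _ := Γ''
    trivial
  | succ n ih =>
    obtain _ | ⟨Γ, A⟩ := Γ
    obtain _ | ⟨Γ', A'⟩ := Γ'
    obtain _ | ⟨Γ'', A''⟩ := Γ''
    rw [isCtx_snoc] at hΓ hΓ'
    exact ⟨ih hΓ.2 hΓ'.2 h.1 h'.1, h.2.tyTrans ((h.1.symm hΓ'.2).convert hΓ.2 h'.2)⟩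

theorem IsSub.convert {n k : ℕ} {Γ Γ' : Ctx T.sig k} {Δ Δ' : Ctx T.sig n} {σ : Sub T.sig n k}
    (hΓ' : T.IsCtx Γ') (hΔ : T.IsCtx Δ) (hΓΓ' : T.CtxEq Γ Γ')
    (hΔΔ' : T.CtxEq Δ Δ') (hΔ' : T.IsCtx Δ') (h : T.IsSub Γ Δ σ) : T.IsSub Γ' Δ' σ := by
  have h₁ : T.IsSub Γ' Δ σ := fun i => hΓΓ'.convert hΓ' (h i)
  exact IsSub.comp hΓ' h₁ ((hΔΔ'.symm hΔ').isSub hΔ)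

theorem SubEq.convert {n k : ℕ} {Γ Γ' : Ctx T.sig k} {Δ Δ' : Ctx T.sig n} {σ τ : Sub T.sig n k}
    (hΓ' : T.IsCtx Γ') (hΔ : T.IsCtx Δ) (hΔ' : T.IsCtx Δ') (hΓΓ' : T.CtxEq Γ Γ')
    (hΔΔ' : T.CtxEq Δ Δ') (hσ : T.IsSub Γ Δ σ) (hτ : T.IsSub Γ Δ τ) (h : T.SubEq Γ Δ σ τ) :
    T.SubEq Γ' Δ' σ τ := by
  have hσ' : T.IsSub Γ' Δ σ := fun i => hΓΓ'.convert hΓ' (hσ i)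
  have hτ' : T.IsSub Γ' Δ τ := fun i => hΓΓ'.convert hΓ' (hτ i)
  have h' : T.SubEq Γ' Δ σ τ := fun i => hΓΓ'.convert hΓ' (h i)
  have hid := (hΔΔ'.symm hΔ').isSub hΔ
  exact SubEq.comp hΓ' hΔ' hσ' hτ' hid hid h' (SubEq.refl hid)

/-! ### The classifying category -/

/-- Equality of well-formed contexts of length `n`. -/
instance ctxSetoid (T : TypeTheory.{u}) (n : ℕ) : Setoid {Γ : Ctx T.sig n // T.IsCtx Γ} where
  r Γ Γ' := T.CtxEq Γ.1 Γ'.1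
  iseqv :=
    ⟨fun Γ => .refl Γ.2, fun {_ Γ'} h => h.symm Γ'.2, fun {Γ Γ' _} h h' => h.trans Γ.2 Γ'.2 h'⟩

/-- Objects of the classifying category: equivalence classes of well-formed contexts of the same
length. -/
structure ClassifyingCategory (T : TypeTheory.{u}) where
  len : ℕ
  cls : Quotient (T.ctxSetoid len)

/-- The object given by a well-formed context. -/
def obj {n : ℕ} (Γ : Ctx T.sig n) (hΓ : T.IsCtx Γ) : ClassifyingCategory T where
  len := n
  cls := ⟦⟨Γ, hΓ⟩⟧

namespace ClassifyingCategory

theorem ind {p : ClassifyingCategory T → Prop}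
    (h : ∀ {n : ℕ} (Γ : Ctx T.sig n) (hΓ : T.IsCtx Γ), p (obj Γ hΓ)) (X : ClassifyingCategory T) :
    p X := by
  obtain ⟨n, X⟩ := X
  induction X using Quotient.ind with
  | _ Γ => exact h Γ.1 Γ.2

/-- A tuple of terms that represents a morphism `X ⟶ Y`: for contexts `Γ`, `Δ` that represent `X`
and `Y` (by `pre_obj_iff` below, it does not matter which), it is of type `Δ` in context `Γ`. -/
def IsPre (X Y : ClassifyingCategory T) (t : Sub T.sig Y.len X.len) : Prop :=
  ∃ Γ Δ, X.cls = ⟦Γ⟧ ∧ Y.cls = ⟦Δ⟧ ∧ T.IsSub Γ.1 Δ.1 t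

/-- Representatives of morphisms. -/
abbrev Pre (X Y : ClassifyingCategory T) := {t : Sub T.sig Y.len X.len // IsPre X Y t}

/-- Equality of representatives: termwise definitional equality. -/
def PreEq (X Y : ClassifyingCategory T) (t s : Sub T.sig Y.len X.len) : Prop :=
  ∃ Γ Δ, X.cls = ⟦Γ⟧ ∧ Y.cls = ⟦Δ⟧ ∧ T.SubEq Γ.1 Δ.1 t s

theorem pre_obj_iff {n k : ℕ} {Γ : Ctx T.sig k} {Δ : Ctx T.sig n} {hΓ : T.IsCtx Γ}
    {hΔ : T.IsCtx Δ} {t : Sub T.sig n k} :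
    IsPre (obj Γ hΓ) (obj Δ hΔ) t ↔ T.IsSub Γ Δ t := by
  constructor
  · rintro ⟨Γ', Δ', h₁, h₂, h⟩
    have h₁' : T.CtxEq Γ Γ'.1 := Quotient.exact h₁
    have h₂' : T.CtxEq Δ Δ'.1 := Quotient.exact h₂
    exact h.convert hΓ Δ'.2 (h₁'.symm Γ'.2) (h₂'.symm Δ'.2) hΔ
  · exact fun h => ⟨⟨Γ, hΓ⟩, ⟨Δ, hΔ⟩, rfl, rfl, h⟩

theorem preEq_obj_iff {n k : ℕ} {Γ : Ctx T.sig k} {Δ : Ctx T.sig n} {hΓ : T.IsCtx Γ}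
    {hΔ : T.IsCtx Δ} {t s : Sub T.sig n k} (ht : T.IsSub Γ Δ t) (hs : T.IsSub Γ Δ s) :
    PreEq (obj Γ hΓ) (obj Δ hΔ) t s ↔ T.SubEq Γ Δ t s := by
  constructor
  · rintro ⟨Γ', Δ', h₁, h₂, h⟩
    have h₁' : T.CtxEq Γ Γ'.1 := Quotient.exact h₁
    have h₂' : T.CtxEq Δ Δ'.1 := Quotient.exact h₂
    exact h.convert hΓ Δ'.2 hΔ (h₁'.symm Γ'.2) (h₂'.symm Δ'.2)
      (ht.convert Γ'.2 hΔ h₁' h₂' Δ'.2) (hs.convert Γ'.2 hΔ h₁' h₂' Δ'.2)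
  · exact fun h => ⟨⟨Γ, hΓ⟩, ⟨Δ, hΔ⟩, rfl, rfl, h⟩

theorem preEq_equivalence (X Y : ClassifyingCategory T) :
    Equivalence (fun t s : Pre X Y => PreEq X Y t.1 s.1) := by
  induction X using ind with
  | _ Γ hΓ =>
  induction Y using ind with
  | _ Δ hΔ =>
  refine ⟨fun t => ?_, fun {t s} h => ?_, fun {t s r} h h' => ?_⟩
  · have ht := pre_obj_iff.1 t.2
    exact (preEq_obj_iff ht ht).2 (.refl ht)
  · have ht := pre_obj_iff.1 t.2
    have hs := pre_obj_iff.1 s.2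
    exact (preEq_obj_iff hs ht).2 (((preEq_obj_iff ht hs).1 h).symm hΓ hΔ ht hs)
  · have ht := pre_obj_iff.1 t.2
    have hs := pre_obj_iff.1 s.2
    have hr := pre_obj_iff.1 r.2
    exact (preEq_obj_iff ht hr).2
      (((preEq_obj_iff ht hs).1 h).trans hΓ hΔ ht hs ((preEq_obj_iff hs hr).1 h'))

instance preSetoid (X Y : ClassifyingCategory T) : Setoid (Pre X Y) where
  r t s := PreEq X Y t.1 s.1
  iseqv := preEq_equivalence X Y

theorem isPre_id (X : ClassifyingCategory T) : IsPre X X (Sub.id X.len) := by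
  induction X using ind with
  | _ Γ hΓ => exact pre_obj_iff.2 (isSub_id hΓ)

theorem IsPre.comp {X Y Z : ClassifyingCategory T} {t : Sub T.sig Y.len X.len}
    {s : Sub T.sig Z.len Y.len} (ht : IsPre X Y t) (hs : IsPre Y Z s) :
    IsPre X Z (Sub.comp t s) := by
  induction X using ind with
  | _ Γ hΓ =>
  induction Y using ind with
  | _ Δ hΔ =>
  induction Z using ind with
  | _ Θ hΘ =>
  exact pre_obj_iff.2 (IsSub.comp hΓ (pre_obj_iff.1 ht) (pre_obj_iff.1 hs))

theorem PreEq.comp {X Y Z : ClassifyingCategory T} {t t' : Sub T.sig Y.len X.len}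
    {s s' : Sub T.sig Z.len Y.len} (ht : IsPre X Y t) (ht' : IsPre X Y t') (hs : IsPre Y Z s)
    (hs' : IsPre Y Z s') (h : PreEq X Y t t') (h' : PreEq Y Z s s') :
    PreEq X Z (Sub.comp t s) (Sub.comp t' s') := by
  induction X using ind with
  | _ Γ hΓ =>
  induction Y using ind with
  | _ Δ hΔ =>
  induction Z using ind with
  | _ Θ hΘ =>
  have ht₁ := pre_obj_iff.1 ht
  have ht₁' := pre_obj_iff.1 ht'
  have hs₁ := pre_obj_iff.1 hs
  have hs₁' := pre_obj_iff.1 hs'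
  exact (preEq_obj_iff (IsSub.comp hΓ ht₁ hs₁) (IsSub.comp hΓ ht₁' hs₁')).2
    (SubEq.comp hΓ hΘ ht₁ ht₁' hs₁ hs₁' ((preEq_obj_iff ht₁ ht₁').1 h)
      ((preEq_obj_iff hs₁ hs₁').1 h'))

/-- The classifying category; composition is given by substitution. -/
instance : Category.{u} (ClassifyingCategory T) where
  Hom X Y := Quotient (preSetoid X Y)
  id X := ⟦⟨Sub.id X.len, isPre_id X⟩⟧
  comp {X Y Z} f g := Quotient.map₂ (fun (t : Pre X Y) (s : Pre Y Z) =>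
      (⟨Sub.comp t.1 s.1, t.2.comp s.2⟩ : Pre X Z))
    (fun t t' h s s' h' => PreEq.comp t.2 t'.2 s.2 s'.2 h h') f g
  id_comp f := by
    induction f using Quotient.ind with
    | _ t => exact congrArg (Quotient.mk _) (Subtype.ext (Sub.id_comp t.1))
  comp_id f := by
    induction f using Quotient.ind with
    | _ t => exact congrArg (Quotient.mk _) (Subtype.ext (Sub.comp_id t.1))
  assoc f g h := by
    induction f using Quotient.ind with
    | _ t =>
    induction g using Quotient.ind with
    | _ s =>
    induction h using Quotient.ind with
    | _ r => exact congrArg (Quotient.mk _) (Subtype.ext (Sub.comp_assoc t.1 s.1 r.1))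

end ClassifyingCategory

/-- The morphism `[Γ] ⟶ [Δ]` represented by a tuple of terms. -/
def hom {n k : ℕ} {Γ : Ctx T.sig k} {Δ : Ctx T.sig n} (hΓ : T.IsCtx Γ) (hΔ : T.IsCtx Δ)
    (t : Sub T.sig n k) (ht : T.IsSub Γ Δ t) : obj Γ hΓ ⟶ obj Δ hΔ :=
  Quotient.mk (ClassifyingCategory.preSetoid (obj Γ hΓ) (obj Δ hΔ))
    ⟨t, ClassifyingCategory.pre_obj_iff.2 ht⟩

/-! ### Display maps, dependent projections and fibrations -/

theorem IsCtx.of_append {n m : ℕ} {Γ : Ctx T.sig n} {Δ : Tel T.sig n m}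
    (h : T.IsCtx (Γ.append Δ)) : T.IsCtx Γ := by
  induction Δ with
  | nil => exact h
  | snoc Δ A ih => exact ih (isCtx_snoc.1 h).2

theorem isSub_drop {n m : ℕ} {Γ : Ctx T.sig n} {Δ : Tel T.sig n m}
    (h : T.IsCtx (Γ.append Δ)) : T.IsSub (Γ.append Δ) Γ (Sub.drop n m) := by
  induction Δ with
  | nil => exact isSub_id h
  | snoc Δ A ih =>
    have h' := isCtx_snoc.1 h
    intro i
    have := (ih h'.2 i).wk h'.1
    rwa [Jdg.ren, Expr.ren_sub] at this

/-- The dependent projection `[Γ, Δ] ⟶ [Γ]`, dropping the final segment `Δ`. -/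
def projection {n m : ℕ} (Γ : Ctx T.sig n) (Δ : Tel T.sig n m) (h : T.IsCtx (Γ.append Δ)) :
    obj (Γ.append Δ) h ⟶ obj Γ h.of_append :=
  hom h h.of_append (Sub.drop n m) (isSub_drop h)

/-- The display map `[Γ, x ∈ A] ⟶ [Γ]`, dropping the last type. -/
def display {n : ℕ} (Γ : Ctx T.sig n) (A : Ty T.sig n) (h : T.IsCtx (Γ.snoc A)) :
    obj (Γ.snoc A) h ⟶ obj Γ (isCtx_snoc.1 h).2 :=
  projection Γ (.snoc .nil A) h

/-- The class of display maps. -/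
inductive displayMaps (T : TypeTheory.{u}) : MorphismProperty (ClassifyingCategory T)
  | mk {n : ℕ} (Γ : Ctx T.sig n) (A : Ty T.sig n) (h : T.IsCtx (Γ.snoc A)) :
      displayMaps T (display Γ A h)

/-- The class of dependent projections. -/
inductive dependentProjections (T : TypeTheory.{u}) : MorphismProperty (ClassifyingCategory T)
  | mk {n m : ℕ} (Γ : Ctx T.sig n) (Δ : Tel T.sig n m) (h : T.IsCtx (Γ.append Δ)) :
      dependentProjections T (projection Γ Δ h)

/-- Fibrations: the morphisms that are isomorphic (as arrows) to dependent projections. -/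
def fibrations (T : TypeTheory.{u}) : MorphismProperty (ClassifyingCategory T) :=
  (dependentProjections T).isoClosure

end TypeTheory

/-! ### Strong sums -/

namespace DTT

/-- The expression with constructor `c` of arity `l` and the given arguments. -/
def Expr.mk {S : Signature.{u}} {k : Kind} {n : ℕ} (c : S.Con k) {l : Arity} (h : S.arity c = l)
    (args : ∀ i : Fin l.length, Expr S (l.get i).1 (n + (l.get i).2)) : Expr S k n :=
  match l, h, args with
  | _, rfl, args => .con c args

/-- Constructors `1`, `*`, `Σ` (binding one variable in its second argument), `p`, `p₀`, `p₁`. -/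
structure SumSymbols (S : Signature.{u}) where
  oneCon : S.Con .ty
  starCon : S.Con .tm
  sigmaCon : S.Con .ty
  pairCon : S.Con .tm
  fstCon : S.Con .tm
  sndCon : S.Con .tm
  arity_one : S.arity oneCon = []
  arity_star : S.arity starCon = []
  arity_sigma : S.arity sigmaCon = [(.ty, 0), (.ty, 1)]
  arity_pair : S.arity pairCon = [(.tm, 0), (.tm, 0)]
  arity_fst : S.arity fstCon = [(.tm, 0)]
  arity_snd : S.arity sndCon = [(.tm, 0)]

namespace SumSymbols

variable {S : Signature.{u}} (s : SumSymbols S)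

/-- The type `1`. -/
def one (n : ℕ) : Ty S n := .mk s.oneCon s.arity_one (fun i => i.elim0)

/-- The term `*`. -/
def star (n : ℕ) : Tm S n := .mk s.starCon s.arity_star (fun i => i.elim0)

/-- The type `Σ x ∈ A. B`. -/
def sigma {n : ℕ} (A : Ty S n) (B : Ty S (n + 1)) : Ty S n :=
  .mk s.sigmaCon s.arity_sigma (fun | 0 => A | 1 => B)

/-- The term `p a b`. -/
def pair {n : ℕ} (a b : Tm S n) : Tm S n :=
  .mk s.pairCon s.arity_pair (fun | 0 => a | 1 => b)

/-- The term `p₀ c`. -/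
def fst {n : ℕ} (c : Tm S n) : Tm S n := .mk s.fstCon s.arity_fst (fun | 0 => c)

/-- The term `p₁ c`. -/
def snd {n : ℕ} (c : Tm S n) : Tm S n := .mk s.sndCon s.arity_snd (fun | 0 => c)

end SumSymbols

end DTT

namespace TypeTheory

open DTT

/-- A type theory has strong sums if it contains a unit type and strong `Σ`-types, together with the
congruence rules for their constructors. The premises include the presuppositions that are usually
left tacit, such as `A ∈ Type` and `B ∈ Type [x ∈ A]` in the rules about `Σ x ∈ A. B`. -/
structure StrongSums (T : TypeTheory.{u}) where
  sym : SumSymbols T.sig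
  one_form {n : ℕ} {Γ : Ctx T.sig n} : T.IsCtx Γ →
    T.Derivable Γ (.isTy (sym.one n))
  star_intro {n : ℕ} {Γ : Ctx T.sig n} : T.IsCtx Γ →
    T.Derivable Γ (.hasTy (sym.star n) (sym.one n))
  one_eta {n : ℕ} {Γ : Ctx T.sig n} {a : Tm T.sig n} :
    T.Derivable Γ (.hasTy a (sym.one n)) →
    T.Derivable Γ (.tmEq a (sym.star n) (sym.one n))
  sigma_form {n : ℕ} {Γ : Ctx T.sig n} {A : Ty T.sig n} {B : Ty T.sig (n + 1)} :
    T.Derivable Γ (.isTy A) → T.Derivable (Γ.snoc A) (.isTy B) →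
    T.Derivable Γ (.isTy (sym.sigma A B))
  pair_intro {n : ℕ} {Γ : Ctx T.sig n} {A : Ty T.sig n} {B : Ty T.sig (n + 1)} {a b : Tm T.sig n} :
    T.Derivable Γ (.isTy A) → T.Derivable (Γ.snoc A) (.isTy B) →
    T.Derivable Γ (.hasTy a A) → T.Derivable Γ (.hasTy b (B.sub (Sub.inst a))) →
    T.Derivable Γ (.hasTy (sym.pair a b) (sym.sigma A B))
  fst_elim {n : ℕ} {Γ : Ctx T.sig n} {A : Ty T.sig n} {B : Ty T.sig (n + 1)} {c : Tm T.sig n} :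
    T.Derivable Γ (.isTy A) → T.Derivable (Γ.snoc A) (.isTy B) →
    T.Derivable Γ (.hasTy c (sym.sigma A B)) →
    T.Derivable Γ (.hasTy (sym.fst c) A)
  snd_elim {n : ℕ} {Γ : Ctx T.sig n} {A : Ty T.sig n} {B : Ty T.sig (n + 1)} {c : Tm T.sig n} :
    T.Derivable Γ (.isTy A) → T.Derivable (Γ.snoc A) (.isTy B) →
    T.Derivable Γ (.hasTy c (sym.sigma A B)) →
    T.Derivable Γ (.hasTy (sym.snd c) (B.sub (Sub.inst (sym.fst c))))
  fst_pair {n : ℕ} {Γ : Ctx T.sig n} {A : Ty T.sig n} {B : Ty T.sig (n + 1)} {a b : Tm T.sig n} :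
    T.Derivable Γ (.isTy A) → T.Derivable (Γ.snoc A) (.isTy B) →
    T.Derivable Γ (.hasTy a A) → T.Derivable Γ (.hasTy b (B.sub (Sub.inst a))) →
    T.Derivable Γ (.tmEq (sym.fst (sym.pair a b)) a A)
  snd_pair {n : ℕ} {Γ : Ctx T.sig n} {A : Ty T.sig n} {B : Ty T.sig (n + 1)} {a b : Tm T.sig n} :
    T.Derivable Γ (.isTy A) → T.Derivable (Γ.snoc A) (.isTy B) →
    T.Derivable Γ (.hasTy a A) → T.Derivable Γ (.hasTy b (B.sub (Sub.inst a))) →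
    T.Derivable Γ (.tmEq (sym.snd (sym.pair a b)) b (B.sub (Sub.inst a)))
  pair_eta {n : ℕ} {Γ : Ctx T.sig n} {A : Ty T.sig n} {B : Ty T.sig (n + 1)} {c : Tm T.sig n} :
    T.Derivable Γ (.isTy A) → T.Derivable (Γ.snoc A) (.isTy B) →
    T.Derivable Γ (.hasTy c (sym.sigma A B)) →
    T.Derivable Γ (.tmEq (sym.pair (sym.fst c) (sym.snd c)) c (sym.sigma A B))
  sigma_congr {n : ℕ} {Γ : Ctx T.sig n} {A A' : Ty T.sig n} {B B' : Ty T.sig (n + 1)} :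
    T.Derivable Γ (.isTy A) → T.Derivable Γ (.isTy A') →
    T.Derivable (Γ.snoc A) (.isTy B) → T.Derivable (Γ.snoc A) (.isTy B') →
    T.Derivable Γ (.tyEq A A') → T.Derivable (Γ.snoc A) (.tyEq B B') →
    T.Derivable Γ (.tyEq (sym.sigma A B) (sym.sigma A' B'))
  pair_congr {n : ℕ} {Γ : Ctx T.sig n} {A : Ty T.sig n} {B : Ty T.sig (n + 1)}
      {a a' b b' : Tm T.sig n} :
    T.Derivable Γ (.isTy A) → T.Derivable (Γ.snoc A) (.isTy B) →
    T.Derivable Γ (.hasTy a A) → T.Derivable Γ (.hasTy a' A) →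
    T.Derivable Γ (.hasTy b (B.sub (Sub.inst a))) →
    T.Derivable Γ (.hasTy b' (B.sub (Sub.inst a))) →
    T.Derivable Γ (.tmEq a a' A) → T.Derivable Γ (.tmEq b b' (B.sub (Sub.inst a))) →
    T.Derivable Γ (.tmEq (sym.pair a b) (sym.pair a' b') (sym.sigma A B))
  fst_congr {n : ℕ} {Γ : Ctx T.sig n} {A : Ty T.sig n} {B : Ty T.sig (n + 1)} {c c' : Tm T.sig n} :
    T.Derivable Γ (.isTy A) → T.Derivable (Γ.snoc A) (.isTy B) →
    T.Derivable Γ (.hasTy c (sym.sigma A B)) → T.Derivable Γ (.hasTy c' (sym.sigma A B)) →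
    T.Derivable Γ (.tmEq c c' (sym.sigma A B)) →
    T.Derivable Γ (.tmEq (sym.fst c) (sym.fst c') A)
  snd_congr {n : ℕ} {Γ : Ctx T.sig n} {A : Ty T.sig n} {B : Ty T.sig (n + 1)} {c c' : Tm T.sig n} :
    T.Derivable Γ (.isTy A) → T.Derivable (Γ.snoc A) (.isTy B) →
    T.Derivable Γ (.hasTy c (sym.sigma A B)) → T.Derivable Γ (.hasTy c' (sym.sigma A B)) →
    T.Derivable Γ (.tmEq c c' (sym.sigma A B)) →
    T.Derivable Γ (.tmEq (sym.snd c) (sym.snd c') (B.sub (Sub.inst (sym.fst c))))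

end TypeTheory

/-! It suffices to replace every dependent projection `[Γ, Δ] ⟶ [Γ]` by a display map over the same
base `[Γ]`, because fibrations are by definition the arrows isomorphic to dependent projections. The
replacement collapses `Δ` to a single type by induction on its length.

For empty `Δ` the projection is the identity of `[Γ]`, and the unit type gives an isomorphism
between `[Γ]` and `[Γ, 1]` over `[Γ]`. For the segment `Δ` followed by a type `B`, suppose that `[Γ,
Δ]` is isomorphic to `[Γ, A]` over `[Γ]`, with inverse tuple `s`. Reindexing `B` along `s` gives
`[Γ, Δ, B] ≅ [Γ, A, B(s)]`, and pairing with the two projections gives `[Γ, A, B(s)] ≅ [Γ, Σ A.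
B(s)]`. Both isomorphisms respect the projections to `[Γ]`, so the induction continues.

The three isomorphisms are `StrongSums.isInverse_one`, `IsInverse.lift` and
`StrongSums.isInverse_sigma`. They are built from tuples of terms and carried to the classifying
category by `IsInverse.iso`. The induction step is `StrongSums.exists_iso_display_snoc`, the
induction itself `StrongSums.exists_iso_display`. -/

namespace DTT

/-! ### Raw substitution into extended tuples and into the strong-sum constructors. -/

variable {S : Signature.{u}}

/-- The tuple `σ` extended by the term `a` for the variable declared last. -/
def Sub.cons {n k : ℕ} (a : Tm S k) (σ : Sub S n k) : Sub S (n + 1) k := Fin.cases a σ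

/-- The tuple of the first `n` variables in scope `n + 1`. -/
def Sub.shift (n : ℕ) : Sub S n (n + 1) := fun i => .var i.succ

theorem Sub.cons_head_tail {n k : ℕ} (σ : Sub S (n + 1) k) :
    Sub.cons (σ 0) (fun i => σ i.succ) = σ := by
  funext i
  exact Fin.cases rfl (fun _ => rfl) i

theorem Expr.sub_shift {κ : Kind} {n : ℕ} (e : Expr S κ n) : e.sub (Sub.shift n) = e.wk :=
  (Expr.ren_eq_sub e _).symm

/-- Instantiating the last variable cancels the weakening introduced by `Sub.lift`. The sum rules
produce types of the first form, while extending a tuple by a term asks for the second. -/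
theorem Expr.sub_lift_inst {κ : Kind} {n k : ℕ} (e : Expr S κ (n + 1)) (σ : Sub S n k)
    (a : Tm S k) : (e.sub σ.lift).sub (Sub.inst a) = e.sub (Sub.cons a σ) := by
  rw [Expr.sub_sub]
  congr 1
  funext i
  refine Fin.cases rfl (fun i => ?_) i
  exact (Expr.wk_sub _ _).trans (Expr.sub_id _)

theorem Sub.comp_cons {n m k : ℕ} (σ : Sub S m k) (a : Tm S m) (τ : Sub S n m) :
    σ.comp (Sub.cons a τ) = Sub.cons (a.sub σ) (σ.comp τ) := by
  funext i
  exact Fin.cases rfl (fun _ => rfl) i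

/-- The arity is known only up to the propositional equality `h`, so `Expr.sub` does not compute on
`Expr.mk` until `h` is eliminated. The lemma does this once for all constructors. -/
theorem Expr.mk_sub {κ : Kind} {n m : ℕ} (c : S.Con κ) {l : Arity} (h : S.arity c = l)
    (args : ∀ i : Fin l.length, Expr S (l.get i).1 (n + (l.get i).2)) (σ : Sub S n m) :
    (Expr.mk c h args).sub σ = Expr.mk c h (fun i => (args i).sub (σ.liftN _)) := by
  subst h
  rfl

namespace SumSymbols

variable (s : SumSymbols S) {n m : ℕ} (σ : Sub S n m)

theorem one_sub : (s.one n).sub σ = s.one m := by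
  rw [one, Expr.mk_sub, one]
  congr 1
  funext i
  exact i.elim0

theorem sigma_sub (A : Ty S n) (B : Ty S (n + 1)) :
    (s.sigma A B).sub σ = s.sigma (A.sub σ) (B.sub σ.lift) := by
  rw [sigma, Expr.mk_sub, sigma]
  congr 1
  funext i
  match i with
  | 0 => rfl
  | 1 => rfl

theorem pair_sub (a b : Tm S n) : (s.pair a b).sub σ = s.pair (a.sub σ) (b.sub σ) := by
  rw [pair, Expr.mk_sub, pair]
  congr 1
  funext i
  match i with
  | 0 => rfl
  | 1 => rfl

theorem fst_sub (c : Tm S n) : (s.fst c).sub σ = s.fst (c.sub σ) := by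
  rw [fst, Expr.mk_sub, fst]
  congr 1
  funext i
  match i with
  | 0 => rfl

theorem snd_sub (c : Tm S n) : (s.snd c).sub σ = s.snd (c.sub σ) := by
  rw [snd, Expr.mk_sub, snd]
  congr 1
  funext i
  match i with
  | 0 => rfl

end SumSymbols

end DTT

/-! ### Typing and equality of extended and lifted tuples. -/

namespace TypeTheory

open DTT

variable {T : TypeTheory.{u}}

theorem IsSub.cons {n k : ℕ} {Γ : Ctx T.sig n} {Γ' : Ctx T.sig k} {σ : Sub T.sig n k}
    {A : Ty T.sig n} {a : Tm T.sig k} (h : T.IsSub Γ' Γ σ)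
    (ha : T.Derivable Γ' (.hasTy a (A.sub σ))) : T.IsSub Γ' (Γ.snoc A) (Sub.cons a σ) := by
  intro i
  refine Fin.cases ?_ (fun i => ?_) i
  · rw [show (Γ.snoc A).get 0 = A.wk from rfl, Expr.wk_sub]
    exact ha
  · rw [show (Γ.snoc A).get i.succ = (Γ.get i).wk from rfl, Expr.wk_sub]
    exact h i

/-- Termwise equality is typed by the left-hand tuple, so only `A.sub σ` occurs in `ha`. This
asymmetry decides in which direction later equalities are proved. -/
theorem SubEq.cons {n k : ℕ} {Γ : Ctx T.sig n} {Γ' : Ctx T.sig k} {σ τ : Sub T.sig n k}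
    {A : Ty T.sig n} {a b : Tm T.sig k} (h : T.SubEq Γ' Γ σ τ)
    (ha : T.Derivable Γ' (.tmEq a b (A.sub σ))) :
    T.SubEq Γ' (Γ.snoc A) (Sub.cons a σ) (Sub.cons b τ) := by
  intro i
  refine Fin.cases ?_ (fun i => ?_) i
  · rw [show (Γ.snoc A).get 0 = A.wk from rfl, Expr.wk_sub]
    exact ha
  · rw [show (Γ.snoc A).get i.succ = (Γ.get i).wk from rfl, Expr.wk_sub]
    exact h i

theorem IsSub.wk {n k : ℕ} {Γ : Ctx T.sig n} {Γ' : Ctx T.sig k} {σ : Sub T.sig n k}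
    {B : Ty T.sig k} (hB : T.Derivable Γ' (.isTy B)) (h : T.IsSub Γ' Γ σ) :
    T.IsSub (Γ'.snoc B) Γ (fun i => (σ i).wk) := by
  intro i
  have := (h i).wk hB
  rwa [Jdg.ren, Expr.ren_sub] at this

theorem SubEq.wk {n k : ℕ} {Γ : Ctx T.sig n} {Γ' : Ctx T.sig k} {σ τ : Sub T.sig n k}
    {B : Ty T.sig k} (hB : T.Derivable Γ' (.isTy B)) (h : T.SubEq Γ' Γ σ τ) :
    T.SubEq (Γ'.snoc B) Γ (fun i => (σ i).wk) (fun i => (τ i).wk) := by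
  intro i
  have := (h i).wk hB
  rwa [Jdg.ren, Expr.ren_sub] at this

/-- Definitional equality of `B` with `A.sub σ` is allowed because transporting a type along an
isomorphism and back returns it only up to definitional equality. -/
theorem IsSub.lift_of_tyEq {n k : ℕ} {Γ : Ctx T.sig n} {Γ' : Ctx T.sig k} {σ : Sub T.sig n k}
    {A : Ty T.sig n} {B : Ty T.sig k} (hB : T.Derivable Γ' (.isTy B)) (h : T.IsSub Γ' Γ σ)
    (hBA : T.Derivable Γ' (.tyEq B (A.sub σ))) : T.IsSub (Γ'.snoc B) (Γ.snoc A) σ.lift := by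
  refine IsSub.cons (h.wk hB) (.conv (.var hB) ?_)
  have := hBA.wk hB
  rwa [Jdg.ren, Expr.ren_sub] at this

theorem IsSub.lift {n k : ℕ} {Γ : Ctx T.sig n} {Γ' : Ctx T.sig k} {σ : Sub T.sig n k}
    {A : Ty T.sig n} (hΓ' : T.IsCtx Γ') (hA : T.Derivable Γ (.isTy A)) (h : T.IsSub Γ' Γ σ) :
    T.IsSub (Γ'.snoc (A.sub σ)) (Γ.snoc A) σ.lift :=
  h.lift_of_tyEq (hA.substitute hΓ' h) (.tyRefl (hA.substitute hΓ' h))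

theorem SubEq.tyEq_id {n : ℕ} {Γ : Ctx T.sig n} {σ : Sub T.sig n n} {A : Ty T.sig n}
    (hΓ : T.IsCtx Γ) (hA : T.Derivable Γ (.isTy A)) (h : T.IsSub Γ Γ σ)
    (he : T.SubEq Γ Γ σ (Sub.id n)) : T.Derivable Γ (.tyEq (A.sub σ) A) := by
  have := Derivable.replTy hΓ h (isSub_id hΓ) he hA
  rwa [Expr.sub_id] at this

theorem SubEq.lift_id {n : ℕ} {Γ : Ctx T.sig n} {σ : Sub T.sig n n} {A : Ty T.sig n}
    (hΓ : T.IsCtx Γ) (hA : T.Derivable Γ (.isTy A)) (h : T.IsSub Γ Γ σ)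
    (he : T.SubEq Γ Γ σ (Sub.id n)) :
    T.SubEq (Γ.snoc A) (Γ.snoc A) σ.lift (Sub.id (n + 1)) := by
  rw [← Sub.lift_id]
  -- The last variable has type `A`, but the comparison takes place at `A(σ)`. The two types agree
  -- because `σ` equals the identity.
  refine SubEq.cons (he.wk hA) (.convEq (.tmRefl (.var hA)) ?_)
  have := (he.tyEq_id hΓ hA h).tySymm.wk hA
  rwa [Jdg.ren, Expr.ren_sub] at this

/-! ### The rules for strong sums along a substitution -/

namespace StrongSums

variable (hT : T.StrongSums) {n k : ℕ} {Γ : Ctx T.sig n} {Δ : Ctx T.sig k} {σ : Sub T.sig n k}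
  {A : Ty T.sig n} {B : Ty T.sig (n + 1)} {a b c : Tm T.sig k}

/-- In the rules of `StrongSums` types and terms share one context. Components of a tuple into an
extension of `Γ` live in `Δ`, with types over `Γ` reindexed by `σ`. The rule is applied to `A.sub σ`
and `B.sub σ.lift`; the five lemmas that follow use the same device. -/
theorem pair_intro_sub (hΔ : T.IsCtx Δ) (hσ : T.IsSub Δ Γ σ) (hA : T.Derivable Γ (.isTy A))
    (hB : T.Derivable (Γ.snoc A) (.isTy B)) (ha : T.Derivable Δ (.hasTy a (A.sub σ)))
    (hb : T.Derivable Δ (.hasTy b (B.sub (Sub.cons a σ)))) :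
    T.Derivable Δ (.hasTy (hT.sym.pair a b) ((hT.sym.sigma A B).sub σ)) := by
  have hA' := hA.substitute hΔ hσ
  rw [SumSymbols.sigma_sub]
  rw [← Expr.sub_lift_inst] at hb
  exact hT.pair_intro hA' (hB.substitute (isCtx_snoc.2 ⟨hA', hΔ⟩) (hσ.lift hΔ hA)) ha hb

theorem fst_elim_sub (hΔ : T.IsCtx Δ) (hσ : T.IsSub Δ Γ σ) (hA : T.Derivable Γ (.isTy A))
    (hB : T.Derivable (Γ.snoc A) (.isTy B))
    (hc : T.Derivable Δ (.hasTy c ((hT.sym.sigma A B).sub σ))) :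
    T.Derivable Δ (.hasTy (hT.sym.fst c) (A.sub σ)) := by
  have hA' := hA.substitute hΔ hσ
  rw [SumSymbols.sigma_sub] at hc
  exact hT.fst_elim hA' (hB.substitute (isCtx_snoc.2 ⟨hA', hΔ⟩) (hσ.lift hΔ hA)) hc

theorem snd_elim_sub (hΔ : T.IsCtx Δ) (hσ : T.IsSub Δ Γ σ) (hA : T.Derivable Γ (.isTy A))
    (hB : T.Derivable (Γ.snoc A) (.isTy B))
    (hc : T.Derivable Δ (.hasTy c ((hT.sym.sigma A B).sub σ))) :
    T.Derivable Δ (.hasTy (hT.sym.snd c) (B.sub (Sub.cons (hT.sym.fst c) σ))) := by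
  have hA' := hA.substitute hΔ hσ
  rw [SumSymbols.sigma_sub] at hc
  rw [← Expr.sub_lift_inst]
  exact hT.snd_elim hA' (hB.substitute (isCtx_snoc.2 ⟨hA', hΔ⟩) (hσ.lift hΔ hA)) hc

theorem fst_pair_sub (hΔ : T.IsCtx Δ) (hσ : T.IsSub Δ Γ σ) (hA : T.Derivable Γ (.isTy A))
    (hB : T.Derivable (Γ.snoc A) (.isTy B)) (ha : T.Derivable Δ (.hasTy a (A.sub σ)))
    (hb : T.Derivable Δ (.hasTy b (B.sub (Sub.cons a σ)))) :
    T.Derivable Δ (.tmEq (hT.sym.fst (hT.sym.pair a b)) a (A.sub σ)) := by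
  have hA' := hA.substitute hΔ hσ
  rw [← Expr.sub_lift_inst] at hb
  exact hT.fst_pair hA' (hB.substitute (isCtx_snoc.2 ⟨hA', hΔ⟩) (hσ.lift hΔ hA)) ha hb

theorem snd_pair_sub (hΔ : T.IsCtx Δ) (hσ : T.IsSub Δ Γ σ) (hA : T.Derivable Γ (.isTy A))
    (hB : T.Derivable (Γ.snoc A) (.isTy B)) (ha : T.Derivable Δ (.hasTy a (A.sub σ)))
    (hb : T.Derivable Δ (.hasTy b (B.sub (Sub.cons a σ)))) :
    T.Derivable Δ (.tmEq (hT.sym.snd (hT.sym.pair a b)) b (B.sub (Sub.cons a σ))) := by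
  have hA' := hA.substitute hΔ hσ
  rw [← Expr.sub_lift_inst] at hb ⊢
  exact hT.snd_pair hA' (hB.substitute (isCtx_snoc.2 ⟨hA', hΔ⟩) (hσ.lift hΔ hA)) ha hb

theorem pair_eta_sub (hΔ : T.IsCtx Δ) (hσ : T.IsSub Δ Γ σ) (hA : T.Derivable Γ (.isTy A))
    (hB : T.Derivable (Γ.snoc A) (.isTy B))
    (hc : T.Derivable Δ (.hasTy c ((hT.sym.sigma A B).sub σ))) :
    T.Derivable Δ (.tmEq (hT.sym.pair (hT.sym.fst c) (hT.sym.snd c)) c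
      ((hT.sym.sigma A B).sub σ)) := by
  have hA' := hA.substitute hΔ hσ
  rw [SumSymbols.sigma_sub] at hc ⊢
  exact hT.pair_eta hA' (hB.substitute (isCtx_snoc.2 ⟨hA', hΔ⟩) (hσ.lift hΔ hA)) hc

end StrongSums

/-! ### Isomorphisms of contexts -/

/-- The tuples `t` and `s` are mutually inverse maps between the contexts `Γ` and `Δ`. -/
structure IsInverse (T : TypeTheory.{u}) {n k : ℕ} (Γ : Ctx T.sig k) (Δ : Ctx T.sig n)
    (t : Sub T.sig n k) (s : Sub T.sig k n) : Prop where
  isSub : T.IsSub Γ Δ t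
  isSub_inv : T.IsSub Δ Γ s
  comp_inv : T.SubEq Γ Γ (t.comp s) (Sub.id k)
  inv_comp : T.SubEq Δ Δ (s.comp t) (Sub.id n)

/-- With `subEq_of_hom_eq` and `exists_hom_eq`, this lets statements about morphisms be proved on
tuples, without further handling of the quotients. -/
theorem hom_eq {n k : ℕ} {Γ : Ctx T.sig k} {Δ : Ctx T.sig n} {hΓ : T.IsCtx Γ} {hΔ : T.IsCtx Δ}
    {t s : Sub T.sig n k} (ht : T.IsSub Γ Δ t) (hs : T.IsSub Γ Δ s) (h : T.SubEq Γ Δ t s) :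
    hom hΓ hΔ t ht = hom hΓ hΔ s hs :=
  Quotient.sound ((ClassifyingCategory.preEq_obj_iff ht hs).2 h)

theorem subEq_of_hom_eq {n k : ℕ} {Γ : Ctx T.sig k} {Δ : Ctx T.sig n} {hΓ : T.IsCtx Γ}
    {hΔ : T.IsCtx Δ} {t s : Sub T.sig n k} {ht : T.IsSub Γ Δ t} {hs : T.IsSub Γ Δ s}
    (h : hom hΓ hΔ t ht = hom hΓ hΔ s hs) : T.SubEq Γ Δ t s :=
  (ClassifyingCategory.preEq_obj_iff ht hs).1 (Quotient.exact h)

theorem exists_hom_eq {n k : ℕ} {Γ : Ctx T.sig k} {Δ : Ctx T.sig n} {hΓ : T.IsCtx Γ}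
    {hΔ : T.IsCtx Δ} (f : obj Γ hΓ ⟶ obj Δ hΔ) : ∃ t ht, hom hΓ hΔ t ht = f := by
  obtain ⟨⟨t, ht⟩, rfl⟩ := Quotient.exists_rep f
  exact ⟨t, ClassifyingCategory.pre_obj_iff.1 ht, rfl⟩

/-- The isomorphism represented by mutually inverse tuples. -/
def IsInverse.iso {n k : ℕ} {Γ : Ctx T.sig k} {Δ : Ctx T.sig n} (hΓ : T.IsCtx Γ)
    (hΔ : T.IsCtx Δ) {t : Sub T.sig n k} {s : Sub T.sig k n} (h : T.IsInverse Γ Δ t s) :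
    obj Γ hΓ ≅ obj Δ hΔ where
  hom := hom hΓ hΔ t h.isSub
  inv := hom hΔ hΓ s h.isSub_inv
  hom_inv_id := hom_eq (h.isSub.comp hΓ h.isSub_inv) (isSub_id hΓ) h.comp_inv
  inv_hom_id := hom_eq (h.isSub_inv.comp hΔ h.isSub) (isSub_id hΔ) h.inv_comp

theorem exists_isInverse {n k : ℕ} {Γ : Ctx T.sig k} {Δ : Ctx T.sig n} {hΓ : T.IsCtx Γ}
    {hΔ : T.IsCtx Δ} (e : obj Γ hΓ ≅ obj Δ hΔ) :
    ∃ t s, ∃ h : T.IsInverse Γ Δ t s, hom hΓ hΔ t h.isSub = e.hom := by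
  obtain ⟨t, ht, hte⟩ := exists_hom_eq e.hom
  obtain ⟨s, hs, hse⟩ := exists_hom_eq e.inv
  refine ⟨t, s, ⟨ht, hs, ?_, ?_⟩, hte⟩
  · have := e.hom_inv_id
    rw [← hte, ← hse] at this
    exact subEq_of_hom_eq (ht := ht.comp hΓ hs) (hs := isSub_id hΓ) this
  · have := e.inv_hom_id
    rw [← hte, ← hse] at this
    exact subEq_of_hom_eq (ht := hs.comp hΔ ht) (hs := isSub_id hΔ) this

/-- Reindexing a type along the inverse of an isomorphism of contexts. -/
theorem IsInverse.lift {n k : ℕ} {Γ : Ctx T.sig k} {Δ : Ctx T.sig n} (hΓ : T.IsCtx Γ)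
    (hΔ : T.IsCtx Δ) {t : Sub T.sig n k} {s : Sub T.sig k n} (h : T.IsInverse Γ Δ t s)
    {A : Ty T.sig k} (hA : T.Derivable Γ (.isTy A)) :
    T.IsInverse (Γ.snoc A) (Δ.snoc (A.sub s)) t.lift s.lift where
  isSub := by
    -- The last type of the target pulls back along `t` to `A(s)(t)`, which equals `A` because
    -- `t.comp s` equals the identity.
    refine h.isSub.lift_of_tyEq hA ?_
    rw [Expr.sub_sub]
    exact (h.comp_inv.tyEq_id hΓ hA (h.isSub.comp hΓ h.isSub_inv)).tySymm
  isSub_inv := h.isSub_inv.lift hΔ hA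
  comp_inv := by
    rw [Sub.lift_comp]
    exact h.comp_inv.lift_id hΓ hA (h.isSub.comp hΓ h.isSub_inv)
  inv_comp := by
    rw [Sub.lift_comp]
    exact h.inv_comp.lift_id hΔ (hA.substitute hΔ h.isSub_inv) (h.isSub_inv.comp hΔ h.isSub)

/-! ### The isomorphisms given by the unit type and by sums. -/

theorem isSub_shift {n : ℕ} {Γ : Ctx T.sig n} {A : Ty T.sig n} (hA : T.Derivable Γ (.isTy A)) :
    T.IsSub (Γ.snoc A) Γ (Sub.shift n) :=
  isSub_drop_one (isCtx_snoc.2 ⟨hA, hA.isCtx⟩)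

theorem Derivable.var_shift {n : ℕ} {Γ : Ctx T.sig n} {A : Ty T.sig n}
    (hA : T.Derivable Γ (.isTy A)) :
    T.Derivable (Γ.snoc A) (.hasTy (.var 0) (A.sub (Sub.shift n))) := by
  rw [Expr.sub_shift]
  exact .var hA

theorem SubEq.refl_shift {n : ℕ} {Γ : Ctx T.sig n} {A : Ty T.sig n}
    (hA : T.Derivable Γ (.isTy A)) : T.SubEq (Γ.snoc A) Γ (Sub.shift n) (Sub.shift n) :=
  .refl (isSub_shift hA)

theorem StrongSums.isInverse_one (hT : T.StrongSums) {n : ℕ} {Γ : Ctx T.sig n}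
    (hΓ : T.IsCtx Γ) :
    T.IsInverse Γ (Γ.snoc (hT.sym.one n)) (Sub.cons (hT.sym.star n) (Sub.id n))
      (Sub.shift n) where
  isSub := by
    refine (isSub_id hΓ).cons ?_
    rw [Expr.sub_id]
    exact hT.star_intro hΓ
  isSub_inv := isSub_shift (hT.one_form hΓ)
  comp_inv := .refl (isSub_id hΓ)
  inv_comp := by
    have h₁ := hT.one_form hΓ
    have hΓ' := isCtx_snoc.2 ⟨h₁, hΓ⟩
    rw [← Sub.cons_head_tail (Sub.id (n + 1)), Sub.comp_cons]
    refine SubEq.cons (.refl_shift h₁) ?_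
    have h₂ := (hT.star_intro hΓ).substitute hΓ' (isSub_shift h₁)
    have h₃ := Derivable.var_shift h₁
    rw [Jdg.sub, SumSymbols.one_sub] at h₂
    rw [SumSymbols.one_sub] at h₃
    rw [Sub.comp_id, SumSymbols.one_sub]
    -- The substituted `*` and the variable are both elements of `1`, hence both equal to `*`.
    exact (hT.one_eta h₂).tmTrans (hT.one_eta h₃).tmSymm

/-- The maps are `(x, y) ↦ p x y` and `z ↦ (p₀ z, p₁ z)` over `Γ`, where `x` is `var 1` and `y` is
`var 0`. The β-equalities give one composite and surjective pairing the other. -/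
theorem StrongSums.isInverse_sigma (hT : T.StrongSums) {n : ℕ} {Γ : Ctx T.sig n}
    {A : Ty T.sig n} {B : Ty T.sig (n + 1)} (hB : T.Derivable (Γ.snoc A) (.isTy B)) :
    T.IsInverse ((Γ.snoc A).snoc B) (Γ.snoc (hT.sym.sigma A B))
      (Sub.cons (hT.sym.pair (.var 1) (.var 0)) (fun i => .var i.succ.succ))
      (Sub.cons (hT.sym.snd (.var 0)) (Sub.cons (hT.sym.fst (.var 0)) (Sub.shift n))) := by
  have hA := (isCtx_snoc.1 hB.isCtx).1
  have hΓ := hA.isCtx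
  have hAB := isCtx_snoc.2 ⟨hB, hB.isCtx⟩
  have hS := hT.sigma_form hA hB
  have hΓS := isCtx_snoc.2 ⟨hS, hΓ⟩
  have h_id := isSub_id hAB
  have hσ : T.IsSub ((Γ.snoc A).snoc B) Γ (fun i => .var i.succ.succ) := h_id.tail.tail
  have h_snd : T.Derivable ((Γ.snoc A).snoc B)
      (.hasTy (.var 0) (B.sub (Sub.cons (.var 1) (fun i => .var i.succ.succ)))) := by
    have := h_id.head
    rwa [← Sub.cons_head_tail (fun i => Sub.id (n + 2) i.succ)] at this
  have h_fst : T.Derivable ((Γ.snoc A).snoc B)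
      (.hasTy (.var 1) (A.sub (fun i => .var i.succ.succ))) := h_id.tail.head
  have h_var := Derivable.var_shift hS
  have ht := hσ.cons (hT.pair_intro_sub hAB hσ hA hB h_fst h_snd)
  have hs := ((isSub_shift hS).cons
    (hT.fst_elim_sub hΓS (isSub_shift hS) hA hB h_var)).cons
    (hT.snd_elim_sub hΓS (isSub_shift hS) hA hB h_var)
  refine ⟨ht, hs, ?_, ?_⟩
  -- With the identity on the left, the last equation is typed at `B(x)`, as in the β-rule for `p₁`,
  -- instead of at `B(p₀ (p x y))`.
  · refine SubEq.symm hAB hAB h_id (ht.comp hAB hs) ?_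
    rw [← Sub.cons_head_tail (Sub.id (n + 2)), Sub.comp_cons, Sub.comp_cons,
      ← Sub.cons_head_tail (fun i => Sub.id (n + 2) i.succ), SumSymbols.snd_sub,
      SumSymbols.fst_sub]
    exact SubEq.cons (SubEq.cons (.refl hσ)
      (hT.fst_pair_sub hAB hσ hA hB h_fst h_snd).tmSymm)
      (hT.snd_pair_sub hAB hσ hA hB h_fst h_snd).tmSymm
  · rw [← Sub.cons_head_tail (Sub.id (n + 1)), Sub.comp_cons, SumSymbols.pair_sub]
    exact SubEq.cons (.refl_shift hS) (hT.pair_eta_sub hΓS (isSub_shift hS) hA hB h_var)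

/-- The compatibilities with projections hold for raw tuples, not merely up to definitional equality
of terms. A composite of two `hom`s unfolds to the `hom` of the composite tuple, so the lemma also
applies to composites. -/
theorem hom_congr {n k : ℕ} {Γ : Ctx T.sig k} {Δ : Ctx T.sig n} {hΓ : T.IsCtx Γ}
    {hΔ : T.IsCtx Δ} {t s : Sub T.sig n k} (ht : T.IsSub Γ Δ t) (hs : T.IsSub Γ Δ s)
    (h : t = s) : hom hΓ hΔ t ht = hom hΓ hΔ s hs := by
  subst h
  rfl

theorem IsInverse.lift_iso_comp_display {n k : ℕ} {Γ : Ctx T.sig k} {Δ : Ctx T.sig n}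
    (hΓ : T.IsCtx Γ) (hΔ : T.IsCtx Δ) {t : Sub T.sig n k} {s : Sub T.sig k n}
    (h : T.IsInverse Γ Δ t s) {A : Ty T.sig k} (hA : T.IsCtx (Γ.snoc A))
    (hA' : T.IsCtx (Δ.snoc (A.sub s))) :
    ((h.lift hΓ hΔ (isCtx_snoc.1 hA).1).iso hA hA').hom ≫ display Δ (A.sub s) hA' =
      display Γ A hA ≫ hom hΓ hΔ t h.isSub :=
  hom_congr (h.isSub.wk (isCtx_snoc.1 hA).1)
    ((isSub_shift (isCtx_snoc.1 hA).1).comp hA h.isSub) (funext fun _ => (Expr.sub_shift _).symm)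

theorem display_comp_projection {n m : ℕ} (Γ : Ctx T.sig n) (Δ : Tel T.sig n m)
    (B : Ty T.sig (n + m)) (h : T.IsCtx (Γ.append (.snoc Δ B))) :
    display (Γ.append Δ) B h ≫ projection Γ Δ (isCtx_snoc.1 h).2 =
      projection Γ (.snoc Δ B) h :=
  hom_congr ((isSub_shift (isCtx_snoc.1 h).1).comp h (isSub_drop (isCtx_snoc.1 h).2))
    (isSub_drop h) (funext fun _ => Expr.sub_shift _)

/-! ### Dependent projections as display maps -/

/-- If a context is isomorphic to `[Γ, x ∈ A]`, then its extension by one type is isomorphic, over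
`Γ`, to an extension of `Γ` by one type. -/
theorem StrongSums.exists_iso_display_snoc (hT : T.StrongSums) {n k : ℕ} {Γ : Ctx T.sig n}
    {A : Ty T.sig n} (hA : T.IsCtx (Γ.snoc A)) {Θ : Ctx T.sig k} {B : Ty T.sig k}
    (h : T.IsCtx (Θ.snoc B)) (e : obj Θ (isCtx_snoc.1 h).2 ≅ obj (Γ.snoc A) hA) :
    ∃ (A' : Ty T.sig n) (hA' : T.IsCtx (Γ.snoc A'))
      (e' : obj (Θ.snoc B) h ≅ obj (Γ.snoc A') hA'),
      e'.hom ≫ display Γ A' hA' = display Θ B h ≫ e.hom ≫ display Γ A hA := by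
  obtain ⟨hB, hΘ⟩ := isCtx_snoc.1 h
  obtain ⟨t, s, hts, hte⟩ := exists_isInverse e
  have hB' := hB.substitute hA hts.isSub_inv
  have hAB := isCtx_snoc.2 ⟨hB', hA⟩
  have hS := isCtx_snoc.2 ⟨hT.sigma_form (isCtx_snoc.1 hA).1 hB', (isCtx_snoc.1 hA).2⟩
  have h₁ := hts.lift_iso_comp_display hΘ hA h hAB
  -- Both sides are represented by the variables of `Γ`, shifted by two.
  have h₂ : ((hT.isInverse_sigma hB').iso hAB hS).hom ≫ display _ _ hS =
      display _ _ hAB ≫ display _ _ hA := rfl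
  refine ⟨_, hS, (hts.lift hΘ hA hB).iso h hAB ≪≫ (hT.isInverse_sigma hB').iso hAB hS, ?_⟩
  rw [Iso.trans_hom, Category.assoc, h₂, reassoc_of% h₁, hte]

/-- The isomorphism lies over the identity of `Γ`, which is stronger than an isomorphism of arrows.
This lets the next summation be formed over the same base. -/
theorem StrongSums.exists_iso_display (hT : T.StrongSums) {n m : ℕ} (Γ : Ctx T.sig n)
    (Δ : Tel T.sig n m) (h : T.IsCtx (Γ.append Δ)) :
    ∃ (A : Ty T.sig n) (hA : T.IsCtx (Γ.snoc A))
      (e : obj (Γ.append Δ) h ≅ obj (Γ.snoc A) hA), e.hom ≫ display Γ A hA = projection Γ Δ h := by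
  induction Δ with
  | nil =>
    exact ⟨_, isCtx_snoc.2 ⟨hT.one_form h, h⟩, (hT.isInverse_one h).iso _ _, rfl⟩
  | snoc Δ B ih =>
    obtain ⟨A, hA, e, he⟩ := ih (isCtx_snoc.1 h).2
    obtain ⟨A', hA', e', he'⟩ := hT.exists_iso_display_snoc hA h e
    rw [he] at he'
    exact ⟨A', hA', e', he'.trans (display_comp_projection Γ Δ B h)⟩

end TypeTheory

theorem mainTheorem11 (T : TypeTheory.{u}) (_hT : T.StrongSums)
    {X Y : T.ClassifyingCategory} (f : X ⟶ Y) (hf : T.fibrations f) :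
    ∃ (X' Y' : T.ClassifyingCategory) (g : X' ⟶ Y'),
      T.displayMaps g ∧ Nonempty (Arrow.mk f ≅ Arrow.mk g) := by
  obtain ⟨_, _, _, ⟨Γ, Δ, h⟩, ⟨i⟩⟩ := hf
  obtain ⟨A, hA, e, he⟩ := _hT.exists_iso_display Γ Δ h
  -- The triangle over `Γ` becomes an isomorphism of arrows with the identity on codomains.
  exact ⟨_, _, _, .mk Γ A hA, ⟨i.symm ≪≫ Arrow.isoMk e (Iso.refl _) (by simpa using he)⟩⟩
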